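/- A semilattice is a commutative semigroup $L$ in which every element is idempotent, ordered by $f\preceq e \iff ef=f$. Let $L$ be a semilattice, let $(G_e)_{e\in L}$ be a family of groups, and let $\varphi_{f,e}:G_e\to G_f$, for all $e,f\in L$ with $e\succeq f$, be homomorphisms such that $\varphi_{e,e}=\mathrm{id}$ and $\varphi_{g,f}\circ\varphi_{f,e}=\varphi_{g,e}$ whenever $e\succeq f\succeq g$. The associated Clifford semigroup (strong semilattice of groups) is the disjoint union $S=\coprod_{e\in L}G_e$ with the product $x\cdot y=\varphi_{ef,e}(x)\,\varphi_{ef,f}(y)$ for $x\in G_e$, $y\in G_f$. Let $\ell^1(S)$ be its complex convolution algebra. For a complex Banach algebra $A$ and $n\ge 0$ let $C_n(A,A)=A\,\widehat{\otimes}\,A^{\widehat{\otimes}n}$ (completed projective tensor products), and let $\mathsf d_n:C_{n+1}(A,A)\to C_n(A,A)$ be the bounded linear map with $$\mathsf d_n(a_0\otimes\cdots\otimes a_{n+1})=\sum_{i=0}^{n}(-1)^i\,a_0\otimes\cdots\otimes a_ia_{i+1}\otimes\cdots\otimes a_{n+1}+(-1)^{n+1}a_{n+1}a_0\otimes a_1\otimes\cdots\otimes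 a_n .$$ For $n\ge1$ put $H_n(A,A)=\ker \mathsf d_{n-1}/\operatorname{im}\mathsf d_n$. Let $A'$ be the dual Banach space of $A$ with the actions $(a\cdot\phi)(x)=\phi(xa)$, $(\phi\cdot a)(x)=\phi(ax)$, let $C^n(A,A')$ be the space of bounded $n$-linear maps $A^n\to A'$, and let $$(\delta^nT)(a_1,\dots,a_{n+1})=a_1\cdot T(a_2,\dots,a_{n+1})+\sum_{j=1}^{n}(-1)^jT(a_1,\dots,a_ja_{j+1},\dots,a_{n+1})+(-1)^{n+1}T(a_1,\dots,a_n)\cdot a_{n+1}.$$ For $n\ge1$ put $H^n(A,A')=\ker\delta^n/\operatorname{im}\delta^{n-1}$. Suppose that every group $G_e$ is amenable (as a discrete group, i.e. $\ell^\infty(G_e)$ has a left-invariant mean). Then $H_n(\ell^1(S),\ell^1(S))=0$ and $H^n(\ell^1(S),\ell^1(S)')=0$ for all $n\ge1$. -/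

import Mathlib

open scoped TensorProduct ENNReal

set_option linter.unusedSectionVars false
set_option linter.unusedSimpArgs false

noncomputable section

/-! ### Strong semilattices of semigroups

A semilattice is a commutative semigroup of idempotents; `SemilatticeInf L` is this notion, with
product `e * f = e ⊓ f` and canonical order `f ≤ e ↔ e ⊓ f = f`. -/

/-- A semilattice diagram of semigroups of shape `L`: transition homomorphisms
`φ_{f,e} : S_e → S_f` for all `f ≤ e`, compatible with identities and composition. -/
structure SemilatticeDiagram (L : Type*) [SemilatticeInf L] (S : L → Type*)
    [∀ e, Semigroup (S e)] where
  /-- The transition homomorphism `S_e → S_f` for `f ≤ e`. -/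
  map : ∀ {e f : L}, f ≤ e → (S e →ₙ* S f)
  map_refl : ∀ (e : L) (x : S e), map (le_refl e) x = x
  map_map : ∀ {e f g : L} (hfe : f ≤ e) (hgf : g ≤ f) (x : S e),
    map hgf (map hfe x) = map (hgf.trans hfe) x

/-- The underlying set `∐_{e ∈ L} S_e` of the strong semilattice of semigroups of a diagram. -/
@[ext]
structure StrongSemilattice {L : Type*} [SemilatticeInf L] {S : L → Type*}
    [∀ e, Semigroup (S e)] (D : SemilatticeDiagram L S) where
  /-- The index `e` of the constituent `S_e` which contains the element. -/
  base : L
  /-- The element, as an element of its constituent. -/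
  val : S base

namespace StrongSemilattice

variable {L : Type*} [SemilatticeInf L] {S : L → Type*} [∀ e, Semigroup (S e)]
  {D : SemilatticeDiagram L S}

/-- `x · y = φ_{ef,e}(x) φ_{ef,f}(y)` for `x ∈ S_e`, `y ∈ S_f`. -/
instance : Mul (StrongSemilattice D) where
  mul x y := ⟨x.base ⊓ y.base, D.map inf_le_left x.val * D.map inf_le_right y.val⟩

theorem mul_def (x y : StrongSemilattice D) :
    x * y = ⟨x.base ⊓ y.base, D.map inf_le_left x.val * D.map inf_le_right y.val⟩ := rfl

theorem mk_eq_mk_map {e f : L} (h : e = f) (x : S e) :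
    (⟨e, x⟩ : StrongSemilattice D) = ⟨f, D.map h.ge x⟩ := by
  subst h
  rw [D.map_refl]

instance : Semigroup (StrongSemilattice D) where
  mul_assoc x y z := by
    simp only [mul_def, map_mul, D.map_map]
    rw [mk_eq_mk_map (inf_assoc x.base y.base z.base)]
    simp only [map_mul, D.map_map, mul_assoc]

end StrongSemilattice

/-! ### The convolution algebra `ℓ¹(S)` of a semigroup -/

/-- The Banach space `ℓ¹(S)` of absolutely summable functions `S → ℂ`. -/
abbrev Ell1 (S : Type*) : Type _ := lp (fun _ : S => ℂ) 1

namespace Ell1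

variable {S : Type*}

theorem summable_norm (f : Ell1 S) : Summable fun s => ‖f s‖ := by
  simpa using (lp.memℓp f).summable (by simp)

theorem norm_eq (f : Ell1 S) : ‖f‖ = ∑' s, ‖f s‖ := by
  simpa using lp.norm_eq_tsum_rpow (p := 1) (by simp) f

theorem summable_norm_mul (f g : Ell1 S) : Summable fun p : S × S => ‖f p.1 * g p.2‖ :=
  f.summable_norm.mul_norm g.summable_norm

/-- The point mass at `s`. -/
def delta [DecidableEq S] (s : S) : Ell1 S := lp.single 1 s (1 : ℂ)

theorem ext_clm [DecidableEq S] {E : Type*} [NormedAddCommGroup E] [NormedSpace ℂ E]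
    {T U : Ell1 S →L[ℂ] E} (h : ∀ s, T (delta s) = U (delta s)) : T = U := by
  ext f
  have hf := lp.hasSum_single (p := 1) (by simp) f
  refine (hf.mapL T).unique ?_
  convert hf.mapL U using 2 with s
  have : lp.single 1 s (f s) = f s • (delta s : Ell1 S) := by
    rw [delta, ← lp.single_smul]
    simp
  simp only [this, map_smul, h]

variable [Semigroup S]

/-- Values of the convolution: `(f * g)(s) = ∑_{tu = s} f(t) g(u)`. -/
def convFun (f g : Ell1 S) (s : S) : ℂ :=
  ∑' p : {p : S × S // p.1 * p.2 = s}, f p.1.1 * g p.1.2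

theorem summable_norm_fiber (f g : Ell1 S) (s : S) :
    Summable fun p : {p : S × S // p.1 * p.2 = s} => ‖f p.1.1 * g p.1.2‖ :=
  (summable_norm_mul f g).subtype {p : S × S | p.1 * p.2 = s}

theorem summable_sigma (f g : Ell1 S) :
    Summable fun q : (Σ s : S, {p : S × S // p.1 * p.2 = s}) =>
      ‖f q.2.1.1 * g q.2.1.2‖ :=
  ((Equiv.sigmaFiberEquiv fun p : S × S => p.1 * p.2).summable_iff
    (f := fun p : S × S => ‖f p.1 * g p.2‖)).2 (summable_norm_mul f g)

theorem norm_convFun_le (f g : Ell1 S) (s : S) :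
    ‖convFun f g s‖ ≤ ∑' p : {p : S × S // p.1 * p.2 = s}, ‖f p.1.1 * g p.1.2‖ :=
  norm_tsum_le_tsum_norm (summable_norm_fiber f g s)

theorem summable_norm_convFun (f g : Ell1 S) : Summable fun s => ‖convFun f g s‖ :=
  Summable.of_nonneg_of_le (fun _ => norm_nonneg _) (norm_convFun_le f g)
    (summable_sigma f g).sigma

/-- Convolution product on `ℓ¹(S)`. -/
instance : Mul (Ell1 S) where
  mul f g := ⟨convFun f g, memℓp_gen (by simpa using summable_norm_convFun f g)⟩

theorem mul_apply (f g : Ell1 S) (s : S) :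
    (f * g) s = ∑' p : {p : S × S // p.1 * p.2 = s}, f p.1.1 * g p.1.2 := rfl

theorem norm_mul_le' (f g : Ell1 S) : ‖f * g‖ ≤ ‖f‖ * ‖g‖ := by
  have h1 : ‖f * g‖ ≤ ∑' s, ∑' p : {p : S × S // p.1 * p.2 = s}, ‖f p.1.1 * g p.1.2‖ := by
    rw [norm_eq]
    exact (summable_norm_convFun f g).tsum_le_tsum (norm_convFun_le f g) (summable_sigma f g).sigma
  have h2 : ∑' s, ∑' p : {p : S × S // p.1 * p.2 = s}, ‖f p.1.1 * g p.1.2‖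
      = ∑' p : S × S, ‖f p.1 * g p.2‖ := by
    rw [← (summable_sigma f g).tsum_sigma]
    exact (Equiv.sigmaFiberEquiv fun p : S × S => p.1 * p.2).tsum_eq
      (fun p : S × S => ‖f p.1 * g p.2‖)
  have h3 : ∑' p : S × S, ‖f p.1 * g p.2‖ = ‖f‖ * ‖g‖ := by
    rw [norm_eq f, norm_eq g, f.summable_norm.tsum_mul_tsum g.summable_norm]
    · simp
    · simpa using summable_norm_mul f g
  exact h1.trans (h2.trans h3).le

theorem mul_add' (f g h : Ell1 S) : f * (g + h) = f * g + f * h := by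
  ext s
  rw [lp.coeFn_add, Pi.add_apply, mul_apply, mul_apply, mul_apply,
    ← (summable_norm_fiber f g s).of_norm.tsum_add (summable_norm_fiber f h s).of_norm]
  simp [mul_add]

theorem add_mul' (f g h : Ell1 S) : (f + g) * h = f * h + g * h := by
  ext s
  rw [lp.coeFn_add, Pi.add_apply, mul_apply, mul_apply, mul_apply,
    ← (summable_norm_fiber f h s).of_norm.tsum_add (summable_norm_fiber g h s).of_norm]
  simp [add_mul]

theorem smul_mul' (c : ℂ) (f g : Ell1 S) : (c • f) * g = c • (f * g) := by
  ext s
  rw [lp.coeFn_smul, Pi.smul_apply, mul_apply, mul_apply, smul_eq_mul, ← tsum_mul_left]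
  simp [mul_assoc]

theorem mul_smul' (c : ℂ) (f g : Ell1 S) : f * (c • g) = c • (f * g) := by
  ext s
  rw [lp.coeFn_smul, Pi.smul_apply, mul_apply, mul_apply, smul_eq_mul, ← tsum_mul_left]
  simp [mul_left_comm]

/-- Convolution as a bounded bilinear map. -/
def mulL : Ell1 S →L[ℂ] Ell1 S →L[ℂ] Ell1 S :=
  LinearMap.mkContinuous₂
    (LinearMap.mk₂ ℂ (fun f g : Ell1 S => f * g) add_mul' smul_mul' mul_add' mul_smul') 1
    (fun f g => by simpa using norm_mul_le' f g)

theorem mulL_apply (f g : Ell1 S) : mulL f g = f * g := rfl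

theorem delta_mul_delta [DecidableEq S] (s t : S) : delta s * delta t = delta (s * t) := by
  ext r
  rw [mul_apply]
  by_cases h : s * t = r
  · subst h
    rw [tsum_eq_single ⟨(s, t), rfl⟩]
    · simp [delta]
    · rintro ⟨⟨a, b⟩, hab⟩ hne
      by_cases ha : a = s
      · have hb : b ≠ t := fun hb => hne (by simp [ha, hb])
        simp [delta, lp.single_apply, Pi.single_apply, hb]
      · simp [delta, lp.single_apply, Pi.single_apply, ha]
  · have : (delta (s * t) : Ell1 S) r = 0 := by
      simp [delta, lp.single_apply, Ne.symm h]
    rw [this]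
    convert tsum_zero with p
    obtain ⟨⟨a, b⟩, hab⟩ := p
    by_cases ha : a = s
    · by_cases hb : b = t
      · subst ha hb
        exact absurd hab h
      · simp [delta, lp.single_apply, Pi.single_apply, hb]
    · simp [delta, lp.single_apply, Pi.single_apply, ha]

theorem mul_assoc' (f g h : Ell1 S) : f * g * h = f * (g * h) := by
  classical
  let P : Ell1 S →L[ℂ] Ell1 S →L[ℂ] Ell1 S →L[ℂ] Ell1 S :=
    (ContinuousLinearMap.compL ℂ (Ell1 S) (Ell1 S) (Ell1 S →L[ℂ] Ell1 S) mulL).comp mulL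
  let Q : Ell1 S →L[ℂ] Ell1 S →L[ℂ] Ell1 S →L[ℂ] Ell1 S :=
    ((ContinuousLinearMap.compL ℂ (Ell1 S) (Ell1 S →L[ℂ] Ell1 S) (Ell1 S →L[ℂ] Ell1 S)).flip
      mulL).comp ((ContinuousLinearMap.compL ℂ (Ell1 S) (Ell1 S) (Ell1 S)).comp mulL)
  have hPQ : P = Q := by
    refine ext_clm fun s => ext_clm fun t => ext_clm fun r => ?_
    change delta s * delta t * delta r = delta s * (delta t * delta r)
    simp only [delta_mul_delta, mul_assoc]
  exact congrArg (fun R => R f g h) hPQ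

theorem zero_mul' (f : Ell1 S) : 0 * f = 0 := by
  simpa using smul_mul' 0 0 f

theorem mul_zero' (f : Ell1 S) : f * 0 = 0 := by
  simpa using mul_smul' 0 f 0

/-- `ℓ¹(S)` is a Banach algebra under convolution (completeness is an instance of `lp`). -/
instance : NonUnitalNormedRing (Ell1 S) :=
  { (inferInstance : NormedAddCommGroup (Ell1 S)) with
    mul := (· * ·)
    left_distrib := mul_add'
    right_distrib := add_mul'
    zero_mul := zero_mul'
    mul_zero := mul_zero'
    mul_assoc := mul_assoc'
    norm_mul_le := norm_mul_le' }

instance : IsScalarTower ℂ (Ell1 S) (Ell1 S) := ⟨smul_mul'⟩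

instance : SMulCommClass ℂ (Ell1 S) (Ell1 S) := ⟨fun c f g => (mul_smul' c f g).symm⟩

end Ell1

/-! ### Simplicial Hochschild homology and cohomology of a Banach algebra -/

namespace Hochschild

/-- `f ↦ ((a_0, …, a_n) ↦ a_0 · f(a_1, …, a_n))` for a left action `l`. -/
def outerLeft {E X : Type*} [NormedAddCommGroup E] [NormedSpace ℂ E] [NormedAddCommGroup X]
    [NormedSpace ℂ X] (l : E →L[ℂ] X →L[ℂ] X) {n : ℕ}
    (f : ContinuousMultilinearMap ℂ (fun _ : Fin n => E) X) :
    ContinuousMultilinearMap ℂ (fun _ : Fin (n + 1) => E) X :=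
  ContinuousLinearMap.uncurryLeft (Ei := fun _ : Fin (n + 1) => E)
    (((ContinuousLinearMap.compContinuousMultilinearMapL ℂ (fun _ : Fin n => E) X X).flip f).comp l)

/-- `f ↦ ((a_0, …, a_n) ↦ f(a_0, …, a_{n-1}) · a_n)` for a right action `r`. -/
def outerRight {E X : Type*} [NormedAddCommGroup E] [NormedSpace ℂ E] [NormedAddCommGroup X]
    [NormedSpace ℂ X] (r : E →L[ℂ] X →L[ℂ] X) {n : ℕ}
    (f : ContinuousMultilinearMap ℂ (fun _ : Fin n => E) X) :
    ContinuousMultilinearMap ℂ (fun _ : Fin (n + 1) => E) X :=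
  ContinuousMultilinearMap.uncurryRight (Ei := fun _ : Fin (n + 1) => E)
    (r.flip.compContinuousMultilinearMap f)

variable {A : Type*} [NonUnitalNormedRing A] [NormedSpace ℂ A] [IsScalarTower ℂ A A]
  [SMulCommClass ℂ A A]

/-- A continuous multilinear map obtained from `f : A^m → X` by substituting for its variables
`F x : Fin m → A`, where `F` is continuous and where, as a function of any one variable `x k`,
only one entry of `F x` varies, and linearly so. -/
def substitute {X : Type*} [SeminormedAddCommGroup X] [NormedSpace ℂ X] {k m : ℕ} (F : (Fin k → A) → Fin m → A)
    (hF : Continuous F)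
    (hlin : ∀ (x : Fin k → A) (i : Fin k), ∃ (j : Fin m) (T : A →ₗ[ℂ] A),
      ∀ v, F (Function.update x i v) = Function.update (F x) j (T v))
    (f : ContinuousMultilinearMap ℂ (fun _ : Fin m => A) X) :
    ContinuousMultilinearMap ℂ (fun _ : Fin k => A) X where
  toFun x := f (F x)
  map_update_add' {inst} x i v w := by
    rw [Subsingleton.elim inst (instDecidableEqFin k)]
    obtain ⟨j, T, h⟩ := hlin x i
    simp only [h, map_add, f.map_update_add]
  map_update_smul' {inst} x i c v := by
    rw [Subsingleton.elim inst (instDecidableEqFin k)]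
    obtain ⟨j, T, h⟩ := hlin x i
    simp only [h, map_smul, f.map_update_smul]
  cont := f.cont.comp hF

/-- `(a_0, …, a_n) ↦ (a_0, …, a_i a_{i+1}, …, a_n)` for `0 ≤ i < n`. -/
def contract {n : ℕ} (i : Fin n) (x : Fin (n + 1) → A) : Fin n → A :=
  Fin.contractNth i.castSucc (· * ·) x

/-- `(a_0, …, a_{n+1}) ↦ (a_{n+1} a_0, a_1, …, a_n)`. -/
def cyclicContract {n : ℕ} (x : Fin (n + 2) → A) : Fin (n + 1) → A :=
  Fin.cons (x (Fin.last (n + 1)) * x 0) fun j : Fin n => x j.succ.castSucc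

theorem continuous_contract {n : ℕ} (i : Fin n) :
    Continuous (contract i : (Fin (n + 1) → A) → Fin n → A) := by
  refine continuous_pi fun j => ?_
  unfold contract Fin.contractNth
  split_ifs <;> fun_prop

theorem continuous_cyclicContract {n : ℕ} :
    Continuous (cyclicContract : (Fin (n + 2) → A) → Fin (n + 1) → A) := by
  refine continuous_pi fun j => ?_
  unfold cyclicContract
  refine Fin.cases ?_ (fun j => ?_) j
  · simp only [Fin.cons_zero]
    fun_prop
  · simp only [Fin.cons_succ]
    fun_prop

theorem contract_update {n : ℕ} (i : Fin n) (x : Fin (n + 1) → A) (k : Fin (n + 1)) :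
    ∃ (j : Fin n) (T : A →ₗ[ℂ] A),
      ∀ v, contract i (Function.update x k v) = Function.update (contract i x) j (T v) := by
  rcases lt_trichotomy (k : ℕ) i with h | h | h
  · refine ⟨⟨k, by omega⟩, LinearMap.id, fun v => funext fun j => ?_⟩
    simp only [contract, Fin.contractNth, Function.update_apply, Fin.ext_iff, LinearMap.id_apply,
      LinearMap.mulRight_apply, Fin.val_castSucc, Fin.val_succ]
    grind
  · refine ⟨⟨k, by omega⟩, LinearMap.mulRight ℂ (x i.succ), fun v => funext fun j => ?_⟩
    simp only [contract, Fin.contractNth, Function.update_apply, Fin.ext_iff, LinearMap.id_apply,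
      LinearMap.mulRight_apply, Fin.val_castSucc, Fin.val_succ]
    grind
  · by_cases h' : (k : ℕ) = i + 1
    · refine ⟨i, LinearMap.mulLeft ℂ (x i.castSucc), fun v => funext fun j => ?_⟩
      simp only [contract, Fin.contractNth, Function.update_apply, Fin.ext_iff, LinearMap.id_apply,
        LinearMap.mulLeft_apply, Fin.val_castSucc, Fin.val_succ]
      grind
    · refine ⟨⟨k - 1, by omega⟩, LinearMap.id, fun v => funext fun j => ?_⟩
      simp only [contract, Fin.contractNth, Function.update_apply, Fin.ext_iff, LinearMap.id_apply,
        LinearMap.mulLeft_apply, Fin.val_castSucc, Fin.val_succ]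
      grind

theorem cyclicContract_update {n : ℕ} (x : Fin (n + 2) → A) (k : Fin (n + 2)) :
    ∃ (j : Fin (n + 1)) (T : A →ₗ[ℂ] A), ∀ v,
      cyclicContract (Function.update x k v) = Function.update (cyclicContract x) j (T v) := by
  by_cases h0 : k = 0
  · refine ⟨0, LinearMap.mulLeft ℂ (x (Fin.last (n + 1))), fun v => funext fun j => ?_⟩
    refine Fin.cases ?_ (fun j => ?_) j <;>
      simp [cyclicContract, h0, Fin.ext_iff]
  by_cases h1 : k = Fin.last (n + 1)
  · refine ⟨0, LinearMap.mulRight ℂ (x 0), fun v => funext fun j => ?_⟩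
    refine Fin.cases ?_ (fun j => ?_) j
    · simp [cyclicContract, Function.update_apply, h1, Fin.ext_iff]
    · have := j.isLt
      simp only [cyclicContract, Function.update_apply, h1, Fin.ext_iff, Fin.cons_succ]
      simp
      omega
  · have hk0 : (k : ℕ) ≠ 0 := fun h => h0 (Fin.ext h)
    have hk1 : (k : ℕ) ≠ n + 1 := fun h => h1 (Fin.ext h)
    refine ⟨⟨k, by omega⟩, LinearMap.id, fun v => funext fun j => ?_⟩
    refine Fin.cases ?_ (fun j => ?_) j
    · simp [cyclicContract, Function.update_apply, Fin.ext_iff, Ne.symm hk0, Ne.symm hk1]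
    · simp [cyclicContract, Function.update_apply, Fin.ext_iff]

/-- `f ↦ ((a_0, …, a_n) ↦ f(a_0, …, a_i a_{i+1}, …, a_n))`. -/
def compContract {X : Type*} [SeminormedAddCommGroup X] [NormedSpace ℂ X] {n : ℕ} (i : Fin n)
    (f : ContinuousMultilinearMap ℂ (fun _ : Fin n => A) X) :
    ContinuousMultilinearMap ℂ (fun _ : Fin (n + 1) => A) X :=
  substitute (contract i) (continuous_contract i) (contract_update i) f

/-- `f ↦ ((a_0, …, a_{n+1}) ↦ f(a_{n+1} a_0, a_1, …, a_n))`. -/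
def compCyclicContract {X : Type*} [SeminormedAddCommGroup X] [NormedSpace ℂ X] {n : ℕ}
    (f : ContinuousMultilinearMap ℂ (fun _ : Fin (n + 1) => A) X) :
    ContinuousMultilinearMap ℂ (fun _ : Fin (n + 2) => A) X :=
  substitute cyclicContract continuous_cyclicContract cyclicContract_update f

theorem compContract_apply {X : Type*} [SeminormedAddCommGroup X] [NormedSpace ℂ X] {n : ℕ}
    (i : Fin n) (f : ContinuousMultilinearMap ℂ (fun _ : Fin n => A) X) (x : Fin (n + 1) → A) :
    compContract i f x = f (contract i x) := rfl

theorem compCyclicContract_apply {X : Type*} [SeminormedAddCommGroup X] [NormedSpace ℂ X] {n : ℕ}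
    (f : ContinuousMultilinearMap ℂ (fun _ : Fin (n + 1) => A) X) (x : Fin (n + 2) → A) :
    compCyclicContract f x = f (cyclicContract x) := rfl

variable (A)

/-- The space `C_n(A, A) = A ⊗̂ A^{⊗̂ n}` of simplicial `n`-chains: the completed projective tensor
product of `n + 1` copies of `A`, of which the one with index `0` is the coefficient module. -/
abbrev Chains (n : ℕ) : Type _ := UniformSpace.Completion (⨂[ℂ] _ : Fin (n + 1), A)

/-- The Hochschild boundary on elementary tensors: `a_0 ⊗ ⋯ ⊗ a_{n+1}` is mapped to
`∑_{i=0}^{n} (-1)^i a_0 ⊗ ⋯ ⊗ a_i a_{i+1} ⊗ ⋯ ⊗ a_{n+1} + (-1)^{n+1} a_{n+1} a_0 ⊗ a_1 ⊗ ⋯ ⊗ a_n`. -/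
def boundaryMultilinear (n : ℕ) :
    ContinuousMultilinearMap ℂ (fun _ : Fin (n + 2) => A) (⨂[ℂ] _ : Fin (n + 1), A) :=
  (∑ i : Fin (n + 1), (-1 : ℂ) ^ (i : ℕ) • compContract i (PiTensorProduct.tprodL ℂ)) +
  (-1 : ℂ) ^ (n + 1) • compCyclicContract (PiTensorProduct.tprodL ℂ)

/-- The Hochschild boundary operator `d_n : C_{n+1}(A, A) → C_n(A, A)`. -/
def boundary (n : ℕ) : Chains A (n + 1) →L[ℂ] Chains A n :=
  (PiTensorProduct.liftIsometry ℂ (fun _ : Fin (n + 2) => A) (⨂[ℂ] _ : Fin (n + 1), A)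
    (boundaryMultilinear A n)).completion

/-- The space `Z_n(A, A)` of `n`-cycles: `Z_0 = C_0` and `Z_{n+1} = ker d_n`. -/
def cycles : (n : ℕ) → Submodule ℂ (Chains A n)
  | 0 => ⊤
  | n + 1 => LinearMap.ker (boundary A n).toLinearMap

/-- The space `B_n(A, A) = im d_n` of `n`-boundaries. -/
def boundaries (n : ℕ) : Submodule ℂ (Chains A n) :=
  LinearMap.range (boundary A n).toLinearMap

/-- The Hochschild homology group `H_n(A, A) = Z_n(A, A) / B_n(A, A)`. -/
abbrev Homology (n : ℕ) : Type _ :=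
  cycles A n ⧸ (boundaries A n).submoduleOf (cycles A n)

/-- The dual Banach space `A'`. -/
abbrev DualModule : Type _ := A →L[ℂ] ℂ

/-- The left action of `A` on `A'`: `(a · φ)(x) = φ(x a)`. -/
def leftAction : A →L[ℂ] DualModule A →L[ℂ] DualModule A :=
  (ContinuousLinearMap.compL ℂ A A ℂ).flip.comp (ContinuousLinearMap.mul ℂ A).flip

/-- The right action of `A` on `A'`: `(φ · a)(x) = φ(a x)`; here `a` is the first argument. -/
def rightAction : A →L[ℂ] DualModule A →L[ℂ] DualModule A :=
  (ContinuousLinearMap.compL ℂ A A ℂ).flip.comp (ContinuousLinearMap.mul ℂ A)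

variable {A} in
theorem leftAction_apply (a : A) (φ : DualModule A) (x : A) : leftAction A a φ x = φ (x * a) := rfl

variable {A} in
theorem rightAction_apply (a : A) (φ : DualModule A) (x : A) :
    rightAction A a φ x = φ (a * x) := rfl

/-- The space `C^n(A, A')` of bounded `n`-linear maps `A^n → A'`. -/
def Cochains (n : ℕ) : Type _ :=
  ContinuousMultilinearMap ℂ (fun _ : Fin n => A) (DualModule A)

instance (n : ℕ) : AddCommGroup (Cochains A n) :=
  inferInstanceAs (AddCommGroup (ContinuousMultilinearMap ℂ (fun _ : Fin n => A) (DualModule A)))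

instance (n : ℕ) : Module ℂ (Cochains A n) :=
  inferInstanceAs (Module ℂ (ContinuousMultilinearMap ℂ (fun _ : Fin n => A) (DualModule A)))

instance (n : ℕ) : FunLike (Cochains A n) (Fin n → A) (DualModule A) :=
  inferInstanceAs (FunLike (ContinuousMultilinearMap ℂ (fun _ : Fin n => A) (DualModule A))
    (Fin n → A) (DualModule A))

variable {A} in
@[ext]
theorem Cochains.ext {n : ℕ} {f g : Cochains A n} (h : ∀ x, f x = g x) : f = g :=
  DFunLike.ext f g h

variable {A} in
theorem Cochains.add_apply {n : ℕ} (f g : Cochains A n) (x : Fin n → A) :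
    (f + g) x = f x + g x := rfl

variable {A} in
theorem Cochains.smul_apply {n : ℕ} (c : ℂ) (f : Cochains A n) (x : Fin n → A) :
    (c • f) x = c • f x := rfl

/-- The cochain `δ f` underlying the coboundary operator. -/
def coboundaryFun (n : ℕ) (f : Cochains A n) : Cochains A (n + 1) :=
  let f' : ContinuousMultilinearMap ℂ (fun _ : Fin n => A) (DualModule A) := f
  show ContinuousMultilinearMap ℂ (fun _ : Fin (n + 1) => A) (DualModule A) from
    outerLeft (leftAction A) f' + (∑ i : Fin n, (-1 : ℂ) ^ ((i : ℕ) + 1) • compContract i f') +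
      (-1 : ℂ) ^ (n + 1) • outerRight (rightAction A) f'

variable {A} in
theorem coboundaryFun_apply (n : ℕ) (f : Cochains A n) (x : Fin (n + 1) → A) :
    coboundaryFun A n f x = leftAction A (x 0) (f (Fin.tail x)) +
      (∑ i : Fin n, (-1 : ℂ) ^ ((i : ℕ) + 1) • f (contract i x)) +
      (-1 : ℂ) ^ (n + 1) • rightAction A (x (Fin.last n)) (f (Fin.init x)) := by
  let f' : ContinuousMultilinearMap ℂ (fun _ : Fin n => A) (DualModule A) := f
  change (outerLeft (leftAction A) f' + (∑ i : Fin n, (-1 : ℂ) ^ ((i : ℕ) + 1) • compContract i f') +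
      (-1 : ℂ) ^ (n + 1) • outerRight (rightAction A) f') x = _
  rw [_root_.add_apply, _root_.add_apply, _root_.sum_apply]
  rfl

/-- The Hochschild coboundary operator `δ^n : C^n(A, A') → C^{n+1}(A, A')`,
`(δ f)(a_0, …, a_n) = a_0 · f(a_1, …, a_n) + ∑_{i<n} (-1)^{i+1} f(a_0, …, a_i a_{i+1}, …, a_n)
+ (-1)^{n+1} f(a_0, …, a_{n-1}) · a_n`. -/
def coboundary (n : ℕ) : Cochains A n →ₗ[ℂ] Cochains A (n + 1) where
  toFun f := coboundaryFun A n f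
  map_add' f g := by
    refine Cochains.ext fun x => ?_
    simp only [Cochains.add_apply, coboundaryFun_apply, map_add, smul_add, Finset.sum_add_distrib]
    abel
  map_smul' c f := by
    refine Cochains.ext fun x => ?_
    simp only [Cochains.smul_apply, coboundaryFun_apply, map_smul, smul_add, Finset.smul_sum,
      RingHom.id_apply, smul_comm c]

variable {A} in
theorem coboundary_apply (n : ℕ) (f : Cochains A n) (x : Fin (n + 1) → A) :
    coboundary A n f x = leftAction A (x 0) (f (Fin.tail x)) +
      (∑ i : Fin n, (-1 : ℂ) ^ ((i : ℕ) + 1) • f (contract i x)) +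
      (-1 : ℂ) ^ (n + 1) • rightAction A (x (Fin.last n)) (f (Fin.init x)) :=
  coboundaryFun_apply n f x

variable {A} in
theorem boundary_tprod (n : ℕ) (x : Fin (n + 2) → A) :
    boundary A n ((PiTensorProduct.tprod ℂ x : ⨂[ℂ] _ : Fin (n + 2), A) : Chains A (n + 1)) =
      (((∑ i : Fin (n + 1), (-1 : ℂ) ^ (i : ℕ) • PiTensorProduct.tprod ℂ (contract i x)) +
        (-1 : ℂ) ^ (n + 1) • PiTensorProduct.tprod ℂ (cyclicContract x) :
          ⨂[ℂ] _ : Fin (n + 1), A) : Chains A n) := by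
  simp [boundary, boundaryMultilinear, compContract_apply, compCyclicContract_apply]

/-- The space `Z^n(A, A') = ker δ^n` of `n`-cocycles. -/
def cocycles (n : ℕ) : Submodule ℂ (Cochains A n) := LinearMap.ker (coboundary A n)

/-- The space `B^n(A, A')` of `n`-coboundaries: `B^0 = 0` and `B^{n+1} = im δ^n`. -/
def coboundaries : (n : ℕ) → Submodule ℂ (Cochains A n)
  | 0 => ⊥
  | n + 1 => LinearMap.range (coboundary A n)

/-- The Hochschild cohomology group `H^n(A, A') = Z^n(A, A') / B^n(A, A')`. -/
abbrev Cohomology (n : ℕ) : Type _ :=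
  cocycles A n ⧸ (coboundaries A n).submoduleOf (cocycles A n)

end Hochschild

/-! ### Amenable groups -/

/-- The left translate `x ↦ f (g x)` of a bounded function `f` on a group. -/
def leftTranslate {G : Type*} [Group G] (g : G) (f : lp (fun _ : G => ℂ) ∞) :
    lp (fun _ : G => ℂ) ∞ :=
  ⟨fun x => f (g * x), memℓp_infty ⟨‖f‖, by
    rintro _ ⟨x, rfl⟩
    exact lp.norm_apply_le_norm (by simp) f (g * x)⟩⟩

/-- A (discrete) group `G` is amenable if there is a left-invariant mean on `ℓ^∞(G)`, that is,
a bounded linear functional `m` with `‖m‖ = m(1) = 1` which is invariant under left translations. -/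
def IsAmenableGroup (G : Type*) [Group G] : Prop :=
  ∃ m : lp (fun _ : G => ℂ) ∞ →L[ℂ] ℂ, ‖m‖ = 1 ∧ m 1 = 1 ∧ ∀ g f, m (leftTranslate g f) = m f

end

/-! Simplicial `n`-cochains of `ℓ¹(S)` correspond to bounded functions on `S^{n+1}`, and so do
functionals on `n`-chains; both claims thus reduce to contracting the complex of bounded functions
with coboundary `bd`, with norm control.

Over a finite subsemilattice `P` of `L` there is a virtual diagonal: the minimal (Möbius)
idempotents `q_p` of `ℓ¹(P)` are orthogonal and sum to an identity, and on the piece cut out by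
`q_p` one uses `∫ g ⊗ g⁻¹ dg` for an invariant mean on `G_p`. Inserting this diagonal after the
coefficient gives an operator `K_P` with `bd K_P + K_P bd = id` in positive degrees, on tuples over
`P` (`bd_insertDiagonal_add`). Its bound depends only on `|P|`.

For infinite `L` these bounds grow with `P`, but a tuple `x` of `n + 1` elements only sees the
subsemilattice `P(x)` generated by its indices, which has at most `2^{n+1}` elements. Since `P(x)`
changes on passing to faces, `x ↦ K_{P(x)} F x` is not itself a homotopy; it is corrected
recursively by `h_{n+1} F x = K F x - bd h_n (K F) x`, where `K = K_{P(x)}` with `P(x)` frozen. As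
`K bd F = F - bd K F` over `P(x)`, the relation `bd h_n + h_{n+1} bd = id` follows from `bd h_n bd =
bd`. The latter passes to the next degree because `bd² = 0`, and holds in degree `0` because
averaging over the diagonal produces traces (`bd_homotopy_bd_zero`).

Cohomology vanishes at once. The homotopy uses means, so it need not come from an operator on
chains; for homology it is applied to functionals. It splits `f` as `g ∘ d + g'` with `‖g'‖ ≤ B ‖f ∘
d‖`, so `|f(y)| ≤ B ‖f ∘ d‖ ‖y‖` for every cycle `y`. Hahn–Banach and a geometric series then yield
a preimage of `y` (`exists_preimage_of_dual_bound`). -/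

/-! ### Simplicial cochains on a semigroup

A simplicial `n`-cochain on a semigroup `S` is a function on `S^{n+1}`. -/

namespace SemigroupCochain

variable {S : Type*} [Semigroup S]

/-- The faces `(x_0, …, x_{n+1}) ↦ (x_0, …, x_i x_{i+1}, …, x_{n+1})` for `i ≤ n`, and
`(x_0, …, x_{n+1}) ↦ (x_{n+1} x_0, x_1, …, x_n)` for `i = n + 1`. -/
def face {n : ℕ} (i : Fin (n + 2)) (x : Fin (n + 2) → S) (k : Fin (n + 1)) : S :=
  if (k : ℕ) < i then
    if (k : ℕ) = 0 ∧ (i : ℕ) = n + 1 then x (Fin.last (n + 1)) * x 0 else x k.castSucc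
  else if (k : ℕ) = i then x k.castSucc * x k.succ else x k.succ

/-- The simplicial identities of the cyclic bar construction; associativity is needed where two
multiplications overlap. -/
theorem face_face {n : ℕ} (i j : Fin (n + 2)) (hij : i ≤ j) (x : Fin (n + 3) → S) :
    face i (face j.succ x) = face j (face i.castSucc x) := by
  funext k
  have hk := k.isLt
  have hi := i.isLt
  have hj := j.isLt
  have hij' : (i : ℕ) ≤ j := hij
  -- Indexing the tuple by `ℕ` turns every case into linear arithmetic on indices.
  obtain ⟨X, hX⟩ : ∃ X : ℕ → S, ∀ k, x k = X k :=
    ⟨fun m => if h : m < n + 3 then x ⟨m, h⟩ else x 0, fun k => by simp⟩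
  simp only [face, Fin.val_castSucc, Fin.val_succ, Fin.val_last, Fin.val_zero, hX]
  grind [mul_assoc]

/-- The simplicial coboundary on cochains of a semigroup. -/
def bd (n : ℕ) : ((Fin (n + 1) → S) → ℂ) →ₗ[ℂ] ((Fin (n + 2) → S) → ℂ) where
  toFun F x := ∑ i : Fin (n + 2), (-1 : ℂ) ^ (i : ℕ) * F (face i x)
  map_add' F F' := by
    funext x
    simp only [Pi.add_apply, mul_add, Finset.sum_add_distrib]
  map_smul' c F := by
    funext x
    simp only [Pi.smul_apply, smul_eq_mul, Finset.mul_sum, RingHom.id_apply, mul_left_comm]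

theorem bd_apply (n : ℕ) (F : (Fin (n + 1) → S) → ℂ) (x : Fin (n + 2) → S) :
    bd n F x = ∑ i : Fin (n + 2), (-1 : ℂ) ^ (i : ℕ) * F (face i x) := rfl

theorem bd_bd (n : ℕ) (F : (Fin (n + 1) → S) → ℂ) : bd (n + 1) (bd n F) = 0 := by
  funext x
  simp only [bd_apply, Finset.mul_sum, ← Finset.sum_product', Pi.zero_apply]
  let P := Fin (n + 3) × Fin (n + 2)
  let T : Finset P := {ij : P | (ij.1 : ℕ) ≤ (ij.2 : ℕ)}
  rw [Finset.univ_product_univ, ← Finset.sum_add_sum_compl T, ← eq_neg_iff_add_eq_zero,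
    ← Finset.sum_neg_distrib]
  -- The term `(i, j)` with `i ≤ j` cancels the term `(j + 1, i)`, by `face_face`.
  let φ : ∀ ij : P, ij ∈ T → P := fun ij hij =>
    (ij.2.succ, Fin.castLT ij.1 (lt_of_le_of_lt (Finset.mem_filter.mp hij).right (Fin.is_lt ij.2)))
  apply Finset.sum_bij φ
  · intro ij hij
    simp_rw [T, φ, Finset.compl_filter, Finset.mem_filter_univ, Fin.val_succ,
      Fin.val_castLT] at hij ⊢
    lia
  · rintro ⟨i, j⟩ hij ⟨i', j'⟩ hij' h
    have h1 := congrArg (fun p => (p.1 : ℕ)) h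
    have h2 := congrArg (fun p => (p.2 : ℕ)) h
    simp only [φ, Fin.val_succ, Fin.val_castLT, Nat.add_right_cancel_iff] at h1 h2
    exact Prod.ext (Fin.ext h2) (Fin.ext h1)
  · rintro ⟨i', j'⟩ hij'
    simp_rw [T, Finset.compl_filter, Finset.mem_filter_univ, not_le] at hij'
    refine ⟨(j'.castSucc, i'.pred ?_), ?_, ?_⟩
    · rintro rfl
      simp at hij'
    · simp only [T, Finset.mem_filter_univ, Fin.val_castSucc, Fin.val_pred]
      omega
    · simp only [φ, Fin.castLT_castSucc, Fin.succ_pred]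
  · rintro ⟨i, j⟩ hij
    have hij' : (i : ℕ) ≤ j := by simpa [T] using hij
    have h := face_face (i.castLT (lt_of_le_of_lt hij' j.isLt)) j hij' x
    rw [Fin.castSucc_castLT] at h
    simp only [φ, Fin.val_succ, Fin.val_castLT, h]
    ring

/-- Insertion of `a ⊗ b` after the coefficient: `(x_0, …, x_n) ↦ (x_0 a, b, x_1, …, x_n)`. -/
def insertPair {n : ℕ} (x : Fin (n + 1) → S) (a b : S) : Fin (n + 2) → S :=
  Fin.cons (x 0 * a) (Fin.cons b (Fin.tail x))

theorem face_zero_insertPair {n : ℕ} (x : Fin (n + 1) → S) (a b : S) :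
    face 0 (insertPair x a b) = Fin.cons (x 0 * a * b) (Fin.tail x) := by
  funext k
  refine Fin.cases ?_ (fun k => ?_) k <;> simp [face, insertPair]

theorem face_one_insertPair {n : ℕ} (x : Fin (n + 2) → S) (a b : S) :
    face 1 (insertPair x a b) =
      Fin.cons (x 0 * a) (Fin.cons (b * x 1) (Fin.tail (Fin.tail x))) := by
  funext k
  refine Fin.cases ?_ (fun k => Fin.cases ?_ (fun k => ?_) k) k
  · simp [face, insertPair]
  · simp only [face, insertPair, Fin.val_succ, Fin.val_zero, Fin.val_one]
    rfl
  · simp [face, insertPair, Fin.tail]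

theorem insertPair_face_zero {n : ℕ} (x : Fin (n + 2) → S) (a b : S) :
    insertPair (face 0 x) a b =
      Fin.cons (x 0 * x 1 * a) (Fin.cons b (Fin.tail (Fin.tail x))) := by
  funext k
  refine Fin.cases ?_ (fun k => Fin.cases ?_ (fun k => ?_) k) k
  · simp [face, insertPair]
  · simp [face, insertPair, Fin.tail]
  · simp [face, insertPair, Fin.tail]

theorem face_succ_succ_insertPair {n : ℕ} (j : Fin (n + 1)) (x : Fin (n + 2) → S) (a b : S) :
    face j.succ.succ (insertPair x a b) = insertPair (face j.succ x) a b := by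
  funext k
  refine Fin.cases ?_ (fun k => Fin.cases ?_ (fun k => ?_) k) k
  · by_cases h : (j : ℕ) = n <;> simp [face, insertPair, Fin.tail, h, mul_assoc, ← Fin.succ_last]
  · simp [face, insertPair, Fin.tail]
  · have h1 : k.succ.succ.castSucc = k.castSucc.succ.succ := rfl
    have h2 : k.succ.castSucc = k.castSucc.succ := rfl
    simp [face, insertPair, Fin.tail, -Fin.castSucc_succ, h1, h2]

theorem norm_bd_le {n : ℕ} {F : (Fin (n + 1) → S) → ℂ} {C : ℝ} (hF : ∀ x, ‖F x‖ ≤ C)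
    (x : Fin (n + 2) → S) : ‖bd n F x‖ ≤ (n + 2) * C := by
  rw [bd_apply]
  refine (norm_sum_le_of_le (n := fun _ => C) _ fun i _ => ?_).trans ?_
  · simpa using hF (face i x)
  · simp

end SemigroupCochain

/-! ### Invariant means on all functions -/

/-- A linear functional on all functions on `G` which restricts to a left-invariant mean on the
bounded ones. -/
structure IsInvariantMean {G : Type*} [Group G] (m : (G → ℂ) →ₗ[ℂ] ℂ) : Prop where
  map_const : ∀ c : ℂ, m (fun _ => c) = c
  norm_le : ∀ {f : G → ℂ} {C : ℝ}, (∀ g, ‖f g‖ ≤ C) → ‖m f‖ ≤ C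
  map_mul_left : ∀ {f : G → ℂ} {C : ℝ}, (∀ g, ‖f g‖ ≤ C) → ∀ h, m (fun g => f (h * g)) = m f

theorem IsAmenableGroup.exists_isInvariantMean {G : Type*} [Group G] (hG : IsAmenableGroup G) :
    ∃ m : (G → ℂ) →ₗ[ℂ] ℂ, IsInvariantMean m := by
  obtain ⟨m, hm, hm1, hinv⟩ := hG
  let ι : lp (fun _ : G => ℂ) ∞ →ₗ[ℂ] (G → ℂ) :=
    { toFun := fun f => ⇑f, map_add' := fun _ _ => rfl, map_smul' := fun _ _ => rfl }
  -- A purely algebraic retraction onto the bounded functions. Its values on unbounded functions are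
  -- arbitrary; it makes the mean linear on all functions, with no boundedness to carry along.
  obtain ⟨r, hr⟩ := ι.exists_leftInverse_of_injective
    (LinearMap.ker_eq_bot.2 fun f g h => lp.ext h)
  have hr' : ∀ f, r (ι f) = f := fun f => LinearMap.congr_fun hr f
  have hmem : ∀ {f : G → ℂ} {C : ℝ}, (∀ g, ‖f g‖ ≤ C) → Memℓp f ∞ := fun {f C} hf =>
    memℓp_infty ⟨C, by rintro _ ⟨g, rfl⟩; exact hf g⟩
  have hval : ∀ f : lp (fun _ : G => ℂ) ∞, m (r ⇑f) = m f := fun f => congrArg m (hr' f)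
  refine ⟨m.toLinearMap ∘ₗ r, ⟨fun c => ?_, fun {f C} hf => ?_, fun {f C} hf h => ?_⟩⟩
  · have : (fun _ => c) = ι (c • (1 : lp (fun _ : G => ℂ) ∞)) := by
      funext g
      change c = c * 1
      rw [mul_one]
    rw [this, LinearMap.comp_apply, hr']
    change m (c • 1) = c
    rw [map_smul, hm1, smul_eq_mul, mul_one]
  · have hC : 0 ≤ C := (norm_nonneg _).trans (hf 1)
    rw [LinearMap.comp_apply]
    refine (congrArg norm (hval ⟨f, hmem hf⟩)).le.trans ((m.le_opNorm _).trans ?_)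
    rw [hm, one_mul]
    exact lp.norm_le_of_forall_le hC hf
  · rw [LinearMap.comp_apply, LinearMap.comp_apply]
    exact (hval (leftTranslate h ⟨f, hmem hf⟩)).trans
      ((hinv h ⟨f, hmem hf⟩).trans (hval ⟨f, hmem hf⟩).symm)

/-! ### Möbius functionals of a finite subsemilattice -/

section Moebius

open Classical in
/-- Evaluation at the minimal idempotent `p - ⋁_{r < p} r` of the subsemilattice `P`: the linear
functional which satisfies `∑_{r ∈ P, r ≤ p} Q_r f = f p`. -/
noncomputable def moebius {L : Type*} [PartialOrder L] (P : Finset L) (p : L) : (L → ℂ) →ₗ[ℂ] ℂ :=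
  LinearMap.proj p - ∑ r ∈ (P.filter (· < p)).attach, moebius P r.1
termination_by (P.filter (· < p)).card
decreasing_by
  have hr := Finset.mem_filter.1 r.2
  refine Finset.card_lt_card (Finset.ssubset_iff_of_subset (fun s hs => ?_) |>.2 ⟨r.1, r.2, ?_⟩)
  · rw [Finset.mem_filter] at hs ⊢
    exact ⟨hs.1, hs.2.trans hr.2⟩
  · simp

variable {L : Type*}

open Classical in
theorem moebius_apply [PartialOrder L] (P : Finset L) (p : L) (f : L → ℂ) :
    moebius P p f = f p - ∑ r ∈ P.filter (· < p), moebius P r f := by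
  rw [moebius, LinearMap.sub_apply, LinearMap.sum_apply, LinearMap.proj_apply,
    Finset.sum_attach (P.filter (· < p)) fun r => moebius P r f]

open Classical in
theorem card_filter_lt_lt_card [PartialOrder L] {P : Finset L} {p r : L}
    (hr : r ∈ P.filter (· < p)) : (P.filter (· < r)).card < (P.filter (· < p)).card := by
  refine Finset.card_lt_card (Finset.ssubset_iff_of_subset (fun s hs => ?_) |>.2 ⟨r, hr, ?_⟩)
  · rw [Finset.mem_filter] at hs hr ⊢
    exact ⟨hs.1, hs.2.trans hr.2⟩
  · simp

open Classical in
/-- Induction along the elements of a finite set that are strictly below a given element. -/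
theorem finset_lt_induction [PartialOrder L] (P : Finset L) {motive : L → Prop}
    (h : ∀ p, (∀ r ∈ P, r < p → motive r) → motive p) (p : L) : motive p := by
  induction hk : (P.filter (· < p)).card using Nat.strong_induction_on generalizing p with
  | _ k ih =>
    exact h p fun r hr hrp => ih _ (hk ▸ card_filter_lt_lt_card
      (Finset.mem_filter.2 ⟨hr, hrp⟩)) r rfl

theorem moebius_congr [PartialOrder L] {P : Finset L} {f f' : L → ℂ} (p : L) (hp : p ∈ P)
    (hf : ∀ u ∈ P, u ≤ p → f u = f' u) : moebius P p f = moebius P p f' := by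
  classical
  induction p using finset_lt_induction P with
  | h p ih =>
    rw [moebius_apply, moebius_apply, hf p hp le_rfl]
    congr 1
    refine Finset.sum_congr rfl fun r hr => ?_
    rw [Finset.mem_filter] at hr
    exact ih r hr.1 hr.2 hr.1 fun u hu hur => hf u hu (hur.trans hr.2.le)

theorem moebius_eq_of_eq_zero [PartialOrder L] {P : Finset L} {f : L → ℂ} (p : L)
    (hf : ∀ u ∈ P, u < p → f u = 0) : moebius P p f = f p := by
  classical
  rw [moebius_apply, Finset.sum_eq_zero, sub_zero]
  intro r hr
  rw [Finset.mem_filter] at hr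
  rw [moebius_congr (f' := 0) r hr.1 fun u hu hur => hf u hu (hur.trans_lt hr.2), map_zero]

open Classical in
theorem sum_moebius_le [PartialOrder L] {P : Finset L} {p : L} (hp : p ∈ P) (f : L → ℂ) :
    ∑ r ∈ P.filter (· ≤ p), moebius P r f = f p := by
  have : P.filter (· ≤ p) = insert p (P.filter (· < p)) := by
    ext r
    simp only [Finset.mem_filter, Finset.mem_insert, le_iff_eq_or_lt]
    constructor
    · rintro ⟨h, h' | h'⟩
      · exact Or.inl h'
      · exact Or.inr ⟨h, h'⟩
    · rintro (rfl | h)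
      · exact ⟨hp, Or.inl rfl⟩
      · exact ⟨h.1, Or.inr h.2⟩
  rw [this, Finset.sum_insert (by simp), moebius_apply, sub_add_cancel]

/-- This is `q_p r = 0` for `p ≰ r`. By induction only those `s < p` with `s ≤ r ⊓ p` contribute to
the recursion, and they add up to `f (r ⊓ p) = f p`. -/
theorem moebius_eq_zero [SemilatticeInf L] {P : Finset L} (hP : InfClosed (P : Set L)) {r : L}
    (hr : r ∈ P) {f : L → ℂ} (hf : ∀ u, f u = f (r ⊓ u)) (p : L) (hp : p ∈ P) (hpr : ¬ p ≤ r) :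
    moebius P p f = 0 := by
  classical
  induction p using finset_lt_induction P with
  | h p ih =>
    have hsub : P.filter (· ≤ r ⊓ p) ⊆ P.filter (· < p) := fun s hs => by
      rw [Finset.mem_filter] at hs ⊢
      exact ⟨hs.1, lt_of_le_of_lt hs.2 (inf_le_right.lt_of_ne fun h => hpr (h ▸ inf_le_left))⟩
    rw [moebius_apply, ← Finset.sum_subset hsub, sum_moebius_le (hP hr hp), ← hf, sub_self]
    intro s hs hs'
    rw [Finset.mem_filter] at hs hs'
    exact ih s hs.1 hs.2 hs.1 fun h => hs' ⟨hs.1, le_inf h hs.2.le⟩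

/-- The `q_p` sum to an identity of `ℓ¹(P)`: against `r` only the `p ≤ r` survive. -/
theorem sum_moebius [SemilatticeInf L] {P : Finset L} (hP : InfClosed (P : Set L)) {r : L}
    (hr : r ∈ P) {f : L → ℂ} (hf : ∀ u, f u = f (r ⊓ u)) : ∑ p ∈ P, moebius P p f = f r := by
  classical
  rw [← sum_moebius_le hr f, ← Finset.sum_subset (Finset.filter_subset (· ≤ r) P)]
  intro p hp hp'
  exact moebius_eq_zero hP hr hf p hp fun h => hp' (Finset.mem_filter.2 ⟨hp, h⟩)

/-- Idempotency of `q_p`: the inner functional vanishes for `u < p`, because `q_p u = 0`. -/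
theorem moebius_moebius [SemilatticeInf L] {P : Finset L} (hP : InfClosed (P : Set L)) {p : L}
    (hp : p ∈ P) (f : L → ℂ) :
    moebius P p (fun u => moebius P p fun v => f (u ⊓ v)) = moebius P p f := by
  rw [moebius_eq_of_eq_zero p]
  · exact moebius_congr p hp fun u _ hu => by rw [inf_eq_right.2 hu]
  · intro u hu hup
    exact moebius_eq_zero hP hu (fun v => by rw [← inf_assoc, inf_idem]) p hp hup.not_ge

/-- Crude, but dependent on `P` only through its cardinality, which is all that the homotopy needs.
-/
theorem norm_moebius_le [PartialOrder L] {P : Finset L} {f : L → ℂ} {C : ℝ} (hf : ∀ u, ‖f u‖ ≤ C)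
    (p : L) : ‖moebius P p f‖ ≤ (P.card + 1) ^ P.card * C := by
  classical
  have hC : 0 ≤ C := (norm_nonneg _).trans (hf p)
  have key : ∀ k p, (P.filter (· < p)).card ≤ k → ‖moebius P p f‖ ≤ (P.card + 1) ^ k * C := by
    intro k
    induction k with
    | zero =>
      intro p hp
      rw [moebius_apply, Finset.card_eq_zero.1 (Nat.le_zero.1 hp)]
      simpa using hf p
    | succ k ih =>
      intro p hp
      have h1 : ‖∑ r ∈ P.filter (· < p), moebius P r f‖ ≤ P.card * ((P.card + 1) ^ k * C) := by
        refine (norm_sum_le_of_le _ fun r hr => ih r ?_).trans ?_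
        · have := card_filter_lt_lt_card hr
          omega
        · rw [Finset.sum_const, nsmul_eq_mul]
          gcongr
          exact Finset.filter_subset _ _
      have h2 : C ≤ (P.card + 1) ^ k * C :=
        le_mul_of_one_le_left hC (one_le_pow₀ (by simp))
      rw [moebius_apply]
      refine (norm_sub_le _ _).trans ?_
      rw [pow_succ]
      linarith [hf p]
  exact key _ p (Finset.card_filter_le _ _)

end Moebius

/-! ### Virtual diagonals of Clifford semigroups -/

namespace StrongSemilattice

variable {L : Type*} [SemilatticeInf L] {G : L → Type*} [∀ e, Group (G e)]
  {D : SemilatticeDiagram L G}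

/-- The identity of `G_e` as an element of the Clifford semigroup. -/
def idem (D : SemilatticeDiagram L G) (e : L) : StrongSemilattice D := ⟨e, 1⟩

/-! ### Multiplication by the central idempotents of the constituents. -/

theorem base_mul (x y : StrongSemilattice D) : (x * y).base = x.base ⊓ y.base := rfl

theorem map_one_eq_one {e f : L} (h : f ≤ e) : D.map h (1 : G e) = 1 := by
  have : D.map h (1 : G e) * D.map h 1 = D.map h 1 := by rw [← map_mul, one_mul]
  exact mul_eq_left.1 this

theorem mk_mul_mk (e : L) (g h : G e) :
    (⟨e, g⟩ * ⟨e, h⟩ : StrongSemilattice D) = ⟨e, g * h⟩ := by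
  rw [mk_eq_mk_map (D := D) (inf_idem e).symm (g * h), mul_def, map_mul]

theorem idem_mul_eq (e : L) (x : StrongSemilattice D) :
    idem D e * x = ⟨e ⊓ x.base, D.map inf_le_right x.val⟩ := by
  change (⟨e ⊓ x.base, (D.map inf_le_left (1 : G e) : G (e ⊓ x.base)) *
    (D.map inf_le_right x.val : G (e ⊓ x.base))⟩ : StrongSemilattice D) = _
  rw [map_one_eq_one, one_mul]

theorem mul_idem_eq (e : L) (x : StrongSemilattice D) :
    x * idem D e = ⟨x.base ⊓ e, D.map inf_le_left x.val⟩ := by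
  change (⟨x.base ⊓ e, (D.map inf_le_left x.val : G (x.base ⊓ e)) *
    (D.map inf_le_right (1 : G e) : G (x.base ⊓ e))⟩ : StrongSemilattice D) = _
  rw [map_one_eq_one, mul_one]

theorem idem_comm (e : L) (x : StrongSemilattice D) : idem D e * x = x * idem D e := by
  rw [idem_mul_eq, mul_idem_eq, mk_eq_mk_map (D := D) (inf_comm e x.base), D.map_map]

theorem idem_mul {e : L} (x : StrongSemilattice D) (h : e ≤ x.base) :
    idem D e * x = ⟨e, D.map h x.val⟩ := by
  rw [idem_mul_eq, mk_eq_mk_map (D := D) (inf_eq_left.2 h), D.map_map]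

theorem mul_idem {e : L} (x : StrongSemilattice D) (h : e ≤ x.base) :
    x * idem D e = ⟨e, D.map h x.val⟩ := by
  rw [← idem_comm, idem_mul x h]

theorem idem_mul_base (x : StrongSemilattice D) : idem D x.base * x = x := by
  rw [idem_mul x le_rfl, D.map_refl]

theorem mul_idem_base (x : StrongSemilattice D) : x * idem D x.base = x := by
  rw [mul_idem x le_rfl, D.map_refl]

theorem idem_mul_idem (e f : L) : idem D e * idem D f = idem D (e ⊓ f) := by
  simp only [idem, mul_def, map_one_eq_one, one_mul]

/-- The virtual diagonal `∑_{p ∈ P} ∫ (q_p g) ⊗ (q_p g⁻¹) dg` of the constituents indexed by the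
finite subsemilattice `P`, where `q_p` are the minimal idempotents of `P`, as a linear functional
on functions of two variables. -/
noncomputable def diagonal (D : SemilatticeDiagram L G) (m : ∀ e, (G e → ℂ) →ₗ[ℂ] ℂ)
    (P : Finset L) : (StrongSemilattice D → StrongSemilattice D → ℂ) →ₗ[ℂ] ℂ :=
  ∑ p ∈ P, moebius P p ∘ₗ LinearMap.pi fun u => moebius P p ∘ₗ LinearMap.pi fun v =>
    m p ∘ₗ LinearMap.pi fun g =>
      LinearMap.proj (idem D v * ⟨p, g⁻¹⟩) ∘ₗ LinearMap.proj (idem D u * ⟨p, g⟩)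

variable {m : ∀ e, (G e → ℂ) →ₗ[ℂ] ℂ} {P : Finset L}

theorem diagonal_apply (W : StrongSemilattice D → StrongSemilattice D → ℂ) :
    diagonal D m P W = ∑ p ∈ P, moebius P p fun u => moebius P p fun v =>
      m p fun g => W (idem D u * ⟨p, g⟩) (idem D v * ⟨p, g⁻¹⟩) := by
  rw [diagonal, LinearMap.sum_apply]
  rfl

theorem diagonal_congr (hP : InfClosed (P : Set L))
    {W W' : StrongSemilattice D → StrongSemilattice D → ℂ}
    (h : ∀ a b, a.base ∈ P → b.base ∈ P → W a b = W' a b) :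
    diagonal D m P W = diagonal D m P W' := by
  rw [diagonal_apply, diagonal_apply]
  refine Finset.sum_congr rfl fun p hp => moebius_congr p hp fun u hu _ =>
    moebius_congr p hp fun v hv _ => congrArg (m p) (funext fun g => h _ _ ?_ ?_)
  · exact hP hu hp
  · exact hP hv hp

theorem norm_diagonal_le (hm : ∀ e, IsInvariantMean (m e))
    {W : StrongSemilattice D → StrongSemilattice D → ℂ} {C : ℝ} (hW : ∀ a b, ‖W a b‖ ≤ C) :
    ‖diagonal D m P W‖ ≤ P.card * ((P.card + 1) ^ P.card * ((P.card + 1) ^ P.card * C)) := by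
  rw [diagonal_apply]
  refine (norm_sum_le_of_le _ fun p _ => norm_moebius_le (fun u => norm_moebius_le (fun v =>
    (hm p).norm_le fun g => hW _ _) p) p).trans ?_
  rw [Finset.sum_const, nsmul_eq_mul]

/-- The product map sends the diagonal to an identity over `P`: `g g⁻¹` makes the integrand constant
in `g`, and there remains `∑ q_p² = ∑ q_p`. -/
theorem diagonal_mul_mul (hm : ∀ e, IsInvariantMean (m e)) (hP : InfClosed (P : Set L))
    (f : StrongSemilattice D → ℂ) {x : StrongSemilattice D} (hx : x.base ∈ P) :
    diagonal D m P (fun a b => f (x * a * b)) = f x := by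
  have key : ∀ p u v (g : G p), x * (idem D u * ⟨p, g⟩) * (idem D v * ⟨p, g⁻¹⟩) =
      x * idem D (u ⊓ v ⊓ p) := by
    intro p u v g
    have h1 : (⟨p, g⟩ : StrongSemilattice D) * (idem D v * ⟨p, g⁻¹⟩) =
        idem D v * idem D p := by
      rw [← mul_assoc, ← idem_comm, mul_assoc, mk_mul_mk, mul_inv_cancel]
      rfl
    rw [mul_assoc, mul_assoc, h1, idem_mul_idem, idem_mul_idem, inf_assoc]
  rw [diagonal_apply]
  simp only [key, (hm _).map_const]
  refine (Finset.sum_congr rfl fun p hp => ?_).trans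
    ((sum_moebius hP hx (f := fun u => f (x * idem D u)) fun u => ?_).trans ?_)
  · rw [moebius_moebius hP hp fun w => f (x * idem D (w ⊓ p))]
    exact moebius_congr p hp fun u _ hu => by rw [inf_eq_left.2 hu]
  · rw [← idem_mul_idem, ← mul_assoc, mul_idem_base]
  · rw [mul_idem_base]

/-- The diagonal commutes with `x`. If `p` lies below the index of `x`, then `x` acts on the summand
as its image `h ∈ G_p`, and substituting `h g` for `g` moves `h` from the second factor to the
first. Otherwise `q_p x = 0` and both sides vanish. Boundedness of `W` is needed for invariance. -/
theorem diagonal_mul_comm (hm : ∀ e, IsInvariantMean (m e)) (hP : InfClosed (P : Set L))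
    {W : StrongSemilattice D → StrongSemilattice D → ℂ} {C : ℝ} (hW : ∀ a b, ‖W a b‖ ≤ C)
    {x : StrongSemilattice D} (hx : x.base ∈ P) :
    diagonal D m P (fun a b => W a (b * x)) = diagonal D m P (fun a b => W (x * a) b) := by
  rw [diagonal_apply, diagonal_apply]
  refine Finset.sum_congr rfl fun p hp => ?_
  by_cases hpx : p ≤ x.base
  · have hr : ∀ g : G p, (⟨p, g⟩ : StrongSemilattice D) * x = ⟨p, g * D.map hpx x.val⟩ := by
      intro g
      rw [← mk_mul_mk, ← idem_mul x hpx, ← mul_assoc]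
      congr 1
      exact (mul_idem_base (⟨p, g⟩ : StrongSemilattice D)).symm
    have hl : ∀ g : G p, x * (⟨p, g⟩ : StrongSemilattice D) = ⟨p, D.map hpx x.val * g⟩ := by
      intro g
      rw [← mk_mul_mk, ← mul_idem x hpx, mul_assoc]
      congr 1
      exact (idem_mul_base (⟨p, g⟩ : StrongSemilattice D)).symm
    refine congrArg _ (funext fun u => congrArg _ (funext fun v => ?_))
    have h1 : ∀ g : G p, idem D v * ⟨p, g⁻¹⟩ * x = idem D v * ⟨p, g⁻¹ * D.map hpx x.val⟩ :=
      fun g => by rw [mul_assoc, hr]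
    have h2 : ∀ g : G p, x * (idem D u * ⟨p, g⟩) = idem D u * ⟨p, D.map hpx x.val * g⟩ :=
      fun g => by rw [← mul_assoc, ← idem_comm, mul_assoc, hl]
    simp only [h1, h2]
    rw [← (hm p).map_mul_left (fun g => hW _ _) (D.map hpx x.val)]
    simp only [mul_inv_rev, inv_mul_cancel_right]
  · trans 0
    · rw [← map_zero (moebius P p)]
      refine congrArg _ (funext fun u => moebius_eq_zero hP hx (fun v => ?_) p hp hpx)
      have : ∀ y : StrongSemilattice D, idem D (x.base ⊓ v) * y * x = idem D v * y * x := by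
        intro y
        rw [inf_comm, ← idem_mul_idem, mul_assoc, mul_assoc, idem_comm x.base, mul_assoc,
          mul_idem_base, mul_assoc]
      simp only [this]
    · refine (moebius_eq_zero hP hx (fun u => ?_) p hp hpx).symm
      have : ∀ y : StrongSemilattice D, x * (idem D (x.base ⊓ u) * y) = x * (idem D u * y) := by
        intro y
        rw [← idem_mul_idem, mul_assoc, ← mul_assoc, mul_idem_base]
      simp only [this]

end StrongSemilattice

/-! ### Contracting homotopies -/

namespace StrongSemilattice

open SemigroupCochain

variable {L : Type*} [SemilatticeInf L] {G : L → Type*} [∀ e, Group (G e)]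
  {D : SemilatticeDiagram L G}

/-- The operator on cochains which inserts the virtual diagonal of `P` after the coefficient. -/
noncomputable def insertDiagonal (D : SemilatticeDiagram L G) (m : ∀ e, (G e → ℂ) →ₗ[ℂ] ℂ)
    (P : Finset L) (n : ℕ) : ((Fin (n + 2) → StrongSemilattice D) → ℂ) →ₗ[ℂ]
      ((Fin (n + 1) → StrongSemilattice D) → ℂ) :=
  LinearMap.pi fun x => diagonal D m P ∘ₗ LinearMap.pi fun a => LinearMap.pi fun b =>
    LinearMap.proj (insertPair x a b)

variable {m : ∀ e, (G e → ℂ) →ₗ[ℂ] ℂ} {P : Finset L} {n : ℕ}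

theorem insertDiagonal_apply (F : (Fin (n + 2) → StrongSemilattice D) → ℂ)
    (x : Fin (n + 1) → StrongSemilattice D) :
    insertDiagonal D m P n F x = diagonal D m P fun a b => F (insertPair x a b) := rfl

/-- In `K_P bd`, face `0` returns `F x` by `diagonal_mul_mul`. Face `1` puts `x 1` to the right of
`b`; `diagonal_mul_comm` moves it to the left of `a`, where it cancels face `0` of `bd K_P`. The
other faces commute with insertion up to an index shift, hence cancel by sign. -/
theorem bd_insertDiagonal_add (hm : ∀ e, IsInvariantMean (m e)) (hP : InfClosed (P : Set L))
    {F : (Fin (n + 2) → StrongSemilattice D) → ℂ} {C : ℝ} (hF : ∀ x, ‖F x‖ ≤ C)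
    {x : Fin (n + 2) → StrongSemilattice D} (hx : ∀ i, (x i).base ∈ P) :
    bd n (insertDiagonal D m P n F) x + insertDiagonal D m P (n + 1) (bd (n + 1) F) x = F x := by
  let W : StrongSemilattice D → StrongSemilattice D → ℂ := fun a b =>
    F (Fin.cons (x 0 * a) (Fin.cons b (Fin.tail (Fin.tail x))))
  let V : Fin (n + 1) → StrongSemilattice D → StrongSemilattice D → ℂ := fun j a b =>
    F (insertPair (face j.succ x) a b)
  have h0 : diagonal D m P (fun a b => F (Fin.cons (x 0 * a * b) (Fin.tail x))) = F x := by
    rw [diagonal_mul_mul hm hP (fun y => F (Fin.cons y (Fin.tail x))) (hx 0), Fin.cons_self_tail]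
  have h1 : diagonal D m P (fun a b => W a (b * x 1)) = diagonal D m P (fun a b => W (x 1 * a) b) :=
    diagonal_mul_comm hm hP (W := W) (fun a b => hF _) (hx 1)
  have h2 : insertDiagonal D m P (n + 1) (bd (n + 1) F) x =
      F x - diagonal D m P (fun a b => W (x 1 * a) b) +
        ∑ j : Fin (n + 1), (-1 : ℂ) ^ (j : ℕ) * diagonal D m P (V j) := by
    have : (fun a b => bd (n + 1) F (insertPair x a b)) =
        (fun a b => F (Fin.cons (x 0 * a * b) (Fin.tail x))) - (fun a b => W a (b * x 1)) +
          ∑ j : Fin (n + 1), (-1 : ℂ) ^ (j : ℕ) • V j := by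
      funext a b
      rw [bd_apply, Fin.sum_univ_succ, Fin.sum_univ_succ]
      simp only [face_zero_insertPair, Fin.succ_zero_eq_one, face_one_insertPair,
        face_succ_succ_insertPair, Pi.add_apply, Pi.sub_apply, Finset.sum_apply, Pi.smul_apply,
        smul_eq_mul, Fin.val_zero, Fin.val_one, Fin.val_succ, W, V]
      rw [← add_assoc]
      congr 1
      · ring
      · exact Finset.sum_congr rfl fun j _ => by ring
    rw [insertDiagonal_apply, this, map_add, map_sub, h0, h1, map_sum]
    simp only [map_smul, smul_eq_mul]
  have h3 : bd n (insertDiagonal D m P n F) x = diagonal D m P (fun a b => W (x 1 * a) b) -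
      ∑ j : Fin (n + 1), (-1 : ℂ) ^ (j : ℕ) * diagonal D m P (V j) := by
    rw [bd_apply, Fin.sum_univ_succ, insertDiagonal_apply, sub_eq_add_neg, ← Finset.sum_neg_distrib]
    congr 1
    · simp only [insertPair_face_zero, Fin.val_zero, pow_zero, one_mul, W, mul_assoc]
    · refine Finset.sum_congr rfl fun j _ => ?_
      rw [insertDiagonal_apply, Fin.val_succ]
      ring
  rw [h2, h3]
  ring

/-- A bound for the norm of the virtual diagonal of a subsemilattice with `N` elements. -/
def diagonalBound (N : ℕ) : ℝ := N * ((N + 1) ^ N * (N + 1) ^ N)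

theorem diagonalBound_nonneg (N : ℕ) : 0 ≤ diagonalBound N := by
  unfold diagonalBound
  positivity

theorem diagonalBound_mono {M N : ℕ} (h : M ≤ N) : diagonalBound M ≤ diagonalBound N := by
  have h' : (M : ℝ) ≤ N := Nat.cast_le.2 h
  have h1 : ((M : ℝ) + 1) ^ M ≤ ((N : ℝ) + 1) ^ N :=
    (pow_le_pow_left₀ (by positivity) (by linarith) M).trans
      (pow_le_pow_right₀ (by linarith [N.cast_nonneg (α := ℝ)]) h)
  unfold diagonalBound
  gcongr

theorem norm_insertDiagonal_le (hm : ∀ e, IsInvariantMean (m e))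
    {F : (Fin (n + 2) → StrongSemilattice D) → ℂ} {C : ℝ} (hF : ∀ x, ‖F x‖ ≤ C)
    (x : Fin (n + 1) → StrongSemilattice D) :
    ‖insertDiagonal D m P n F x‖ ≤ diagonalBound P.card * C := by
  refine (norm_diagonal_le hm fun a b => hF _).trans (le_of_eq ?_)
  unfold diagonalBound
  ring

/-- Two cochains agree on the constituents indexed by `P`. -/
def AgreeOn (P : Finset L) (F F' : (Fin (n + 1) → StrongSemilattice D) → ℂ) : Prop :=
  ∀ x : Fin (n + 1) → StrongSemilattice D, (∀ i, (x i).base ∈ P) → F x = F' x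

/-! ### Locality of the operators, and the subsemilattice generated by a tuple. -/

theorem base_face_mem (hP : InfClosed (P : Set L)) {x : Fin (n + 2) → StrongSemilattice D}
    (hx : ∀ i, (x i).base ∈ P) (i : Fin (n + 2)) (k : Fin (n + 1)) : (face i x k).base ∈ P := by
  unfold face
  split_ifs
  · exact hP (hx _) (hx _)
  · exact hx _
  · exact hP (hx _) (hx _)
  · exact hx _

theorem AgreeOn.bd (hP : InfClosed (P : Set L))
    {F F' : (Fin (n + 1) → StrongSemilattice D) → ℂ} (h : AgreeOn P F F') :
    AgreeOn P (bd n F) (bd n F') := fun x hx => by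
  rw [bd_apply, bd_apply]
  exact Finset.sum_congr rfl fun i _ => by rw [h _ (base_face_mem hP hx i)]

theorem AgreeOn.insertDiagonal {P' : Finset L} (hP : InfClosed (P : Set L))
    (hP' : InfClosed (P' : Set L)) (hPP' : P' ⊆ P)
    {F F' : (Fin (n + 2) → StrongSemilattice D) → ℂ} (h : AgreeOn P F F') :
    AgreeOn P (insertDiagonal D m P' n F) (insertDiagonal D m P' n F') := fun x hx => by
  refine diagonal_congr hP' fun a b ha hb => h _ fun i => ?_
  refine Fin.cases ?_ (fun i => Fin.cases ?_ (fun i => ?_) i) i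
  · exact hP (hx 0) (hPP' ha)
  · exact hPP' hb
  · exact hx i.succ

open Classical in
/-- The subsemilattice of `L` generated by the indices of the entries of a tuple. -/
noncomputable def indexClosure (x : Fin (n + 1) → StrongSemilattice D) : Finset L :=
  Finset.univ.image fun t : {t : Finset (Fin (n + 1)) // t.Nonempty} =>
    t.1.inf' t.2 fun i => (x i).base

theorem mem_indexClosure {x : Fin (n + 1) → StrongSemilattice D} {e : L} :
    e ∈ indexClosure x ↔ ∃ (t : Finset (Fin (n + 1))) (ht : t.Nonempty),
      t.inf' ht (fun i => (x i).base) = e := by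
  simp [indexClosure]

theorem card_indexClosure_le (x : Fin (n + 1) → StrongSemilattice D) :
    (indexClosure x).card ≤ 2 ^ (n + 1) := by
  classical
  refine Finset.card_image_le.trans ?_
  rw [Finset.card_univ]
  refine (Fintype.card_subtype_le _).trans ?_
  simp

theorem base_mem_indexClosure (x : Fin (n + 1) → StrongSemilattice D) (i : Fin (n + 1)) :
    (x i).base ∈ indexClosure x :=
  mem_indexClosure.2 ⟨{i}, Finset.singleton_nonempty i, by simp⟩

theorem infClosed_indexClosure (x : Fin (n + 1) → StrongSemilattice D) :
    InfClosed (indexClosure x : Set L) := by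
  classical
  intro e he f hf
  obtain ⟨s, hs, rfl⟩ := mem_indexClosure.1 he
  obtain ⟨t, ht, rfl⟩ := mem_indexClosure.1 hf
  exact mem_indexClosure.2 ⟨s ∪ t, hs.mono Finset.subset_union_left, Finset.inf'_union hs ht _⟩

theorem indexClosure_subset (hP : InfClosed (P : Set L))
    {x : Fin (n + 1) → StrongSemilattice D} (hx : ∀ i, (x i).base ∈ P) :
    indexClosure x ⊆ P := by
  intro e he
  obtain ⟨t, ht, rfl⟩ := mem_indexClosure.1 he
  exact Finset.inf'_mem (P : Set L) (fun a ha b hb => hP ha hb) _ ht _ fun i _ => hx i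

theorem indexClosure_congr {x y : Fin (n + 1) → StrongSemilattice D}
    (h : ∀ i, (x i).base = (y i).base) : indexClosure x = indexClosure y := by
  simp only [indexClosure, h]

/-- The contracting homotopy of the simplicial cochain complex, defined on cochains of degree
`n + 1`. -/
noncomputable def homotopy (D : SemilatticeDiagram L G) (m : ∀ e, (G e → ℂ) →ₗ[ℂ] ℂ) :
    (n : ℕ) → ((Fin (n + 2) → StrongSemilattice D) → ℂ) →ₗ[ℂ]
      ((Fin (n + 1) → StrongSemilattice D) → ℂ)
  | 0 => LinearMap.pi fun x => LinearMap.proj x ∘ₗ insertDiagonal D m (indexClosure x) 0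
  | n + 1 => LinearMap.pi fun x => LinearMap.proj x ∘ₗ
      (LinearMap.id - bd n ∘ₗ homotopy D m n) ∘ₗ insertDiagonal D m (indexClosure x) (n + 1)

theorem homotopy_zero_apply (F : (Fin 2 → StrongSemilattice D) → ℂ)
    (x : Fin 1 → StrongSemilattice D) :
    homotopy D m 0 F x = insertDiagonal D m (indexClosure x) 0 F x := rfl

/-- The subsemilattice is frozen at `x`, even where `bd` and the lower homotopy evaluate at other
tuples. The second term corrects for the dependence of the diagonal on the tuple. -/
theorem homotopy_succ_apply (F : (Fin (n + 3) → StrongSemilattice D) → ℂ)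
    (x : Fin (n + 2) → StrongSemilattice D) :
    homotopy D m (n + 1) F x = insertDiagonal D m (indexClosure x) (n + 1) F x -
      bd n (homotopy D m n (insertDiagonal D m (indexClosure x) (n + 1) F)) x := rfl

/-- A tuple over `P` generates a subsemilattice of `P`, so no evaluation leaves `P`. This allows an
identity known only over `P` to be used inside the homotopy. -/
theorem AgreeOn.homotopy (hP : InfClosed (P : Set L))
    {F F' : (Fin (n + 2) → StrongSemilattice D) → ℂ} (h : AgreeOn P F F') :
    AgreeOn P (homotopy D m n F) (homotopy D m n F') := by
  induction n with
  | zero =>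
    intro x hx
    exact h.insertDiagonal hP (infClosed_indexClosure x) (indexClosure_subset hP hx) x hx
  | succ n ih =>
    intro x hx
    have h' : AgreeOn P (StrongSemilattice.insertDiagonal D m (indexClosure x) (n + 1) F) _ :=
      h.insertDiagonal hP (infClosed_indexClosure x) (indexClosure_subset hP hx)
    rw [homotopy_succ_apply, homotopy_succ_apply, h' x hx, (ih h').bd hP x hx]

/-- A bound for the norm of the contracting homotopy in degree `n + 1`. -/
noncomputable def homotopyBound : ℕ → ℝ
  -- Here `2 = 2 ^ (0 + 1)` bounds the size of the index closure; the factor `n + 2` below counts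
  -- the faces in `bd n`.
  | 0 => diagonalBound 2
  | n + 1 => diagonalBound (2 ^ (n + 2)) +
      (n + 2) * (homotopyBound n * diagonalBound (2 ^ (n + 2)))

theorem homotopyBound_nonneg (n : ℕ) : 0 ≤ homotopyBound n := by
  induction n with
  | zero => exact diagonalBound_nonneg 2
  | succ n ih =>
    have := diagonalBound_nonneg (2 ^ (n + 2))
    unfold homotopyBound
    positivity

theorem norm_insertDiagonal_indexClosure_le (hm : ∀ e, IsInvariantMean (m e)) {k : ℕ}
    (y : Fin (k + 1) → StrongSemilattice D)
    {F : (Fin (n + 2) → StrongSemilattice D) → ℂ} {C : ℝ} (hF : ∀ x, ‖F x‖ ≤ C)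
    (x : Fin (n + 1) → StrongSemilattice D) :
    ‖insertDiagonal D m (indexClosure y) n F x‖ ≤ diagonalBound (2 ^ (k + 1)) * C :=
  (norm_insertDiagonal_le hm hF x).trans (mul_le_mul_of_nonneg_right
    (diagonalBound_mono (card_indexClosure_le y))
    ((norm_nonneg _).trans (hF (insertPair x (x 0) (x 0)))))

theorem norm_homotopy_le (hm : ∀ e, IsInvariantMean (m e))
    {F : (Fin (n + 2) → StrongSemilattice D) → ℂ} {C : ℝ} (hF : ∀ x, ‖F x‖ ≤ C)
    (x : Fin (n + 1) → StrongSemilattice D) : ‖homotopy D m n F x‖ ≤ homotopyBound n * C := by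
  induction n generalizing C with
  | zero => exact norm_insertDiagonal_indexClosure_le hm x hF x
  | succ n ih =>
    have h1 := norm_insertDiagonal_indexClosure_le hm x hF
    rw [homotopy_succ_apply]
    refine (norm_sub_le _ _).trans ((add_le_add (h1 x) (norm_bd_le (fun y => ih h1 y) x)).trans
      (le_of_eq ?_))
    rw [homotopyBound]
    ring

/-- The contracting homotopy is one in positive degrees, provided that it is one on coboundaries
one degree below. -/
theorem bd_homotopy_add_of_bd_homotopy_bd (hm : ∀ e, IsInvariantMean (m e))
    (hn : ∀ (u : (Fin (n + 1) → StrongSemilattice D) → ℂ) (C : ℝ), (∀ x, ‖u x‖ ≤ C) →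
      bd n (homotopy D m n (bd n u)) = bd n u)
    {F : (Fin (n + 2) → StrongSemilattice D) → ℂ} {C : ℝ} (hF : ∀ x, ‖F x‖ ≤ C) :
    bd n (homotopy D m n F) + homotopy D m (n + 1) (bd (n + 1) F) = F := by
  funext x
  have hP := infClosed_indexClosure x
  have hx := base_mem_indexClosure x
  have h1 : AgreeOn (indexClosure x)
      (insertDiagonal D m (indexClosure x) (n + 1) (bd (n + 1) F))
      (F - bd n (insertDiagonal D m (indexClosure x) n F)) := fun y hy => by
    rw [Pi.sub_apply, ← bd_insertDiagonal_add hm hP hF hy, add_sub_cancel_left]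
  rw [Pi.add_apply, homotopy_succ_apply, h1 x hx, (h1.homotopy hP).bd hP x hx, map_sub, map_sub,
    hn _ _ (norm_insertDiagonal_le hm hF)]
  simp only [Pi.sub_apply]
  ring

/-- On `bd u` the homotopy returns `f` minus its average `s ↦ ∫ f (b s a)`. The average takes the
same value at `x 0 * x 1` and `x 1 * x 0`, so `bd` kills it. -/
theorem bd_homotopy_bd_zero (hm : ∀ e, IsInvariantMean (m e))
    {u : (Fin 1 → StrongSemilattice D) → ℂ} {C : ℝ} (hu : ∀ x, ‖u x‖ ≤ C) :
    bd 0 (homotopy D m 0 (bd 0 u)) = bd 0 u := by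
  let f : StrongSemilattice D → ℂ := fun s => u fun _ => s
  have hbd : ∀ (v : (Fin 1 → StrongSemilattice D) → ℂ) (x : Fin 2 → StrongSemilattice D),
      bd 0 v x = v (fun _ => x 0 * x 1) - v (fun _ => x 1 * x 0) := by
    intro v x
    rw [bd_apply, Fin.sum_univ_two, sub_eq_add_neg]
    congr 1
    · simp only [Fin.val_zero, pow_zero, one_mul]
      congr 1
      funext k
      obtain rfl : k = 0 := Subsingleton.elim (α := Fin 1) k 0
      simp [face]
    · simp only [Fin.val_one, pow_one, neg_mul, one_mul]
      congr 2
      funext k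
      obtain rfl : k = 0 := Subsingleton.elim (α := Fin 1) k 0
      simp [face]
  have h1 : ∀ (P : Finset L) (_ : InfClosed (P : Set L)) (s : StrongSemilattice D)
      (_ : s.base ∈ P), insertDiagonal D m P 0 (bd 0 u) (fun _ => s) =
        f s - diagonal D m P fun a b => f (b * s * a) := by
    intro P hP s hs
    rw [← diagonal_mul_mul hm hP f hs, ← map_sub, insertDiagonal_apply]
    congr 1
    funext a b
    rw [hbd]
    simp [insertPair, f, mul_assoc]
  funext x
  rw [hbd, hbd, homotopy_zero_apply, homotopy_zero_apply]
  have hc : indexClosure (fun _ : Fin 1 => x 1 * x 0) = indexClosure (fun _ => x 0 * x 1) :=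
    indexClosure_congr fun _ => inf_comm _ _
  rw [hc]
  generalize hPdef : indexClosure (fun _ : Fin 1 => x 0 * x 1) = P
  have hP : InfClosed (P : Set L) := hPdef ▸ infClosed_indexClosure _
  have h01 : (x 0 * x 1).base ∈ P := hPdef ▸ base_mem_indexClosure (fun _ => x 0 * x 1) 0
  have h10 : (x 1 * x 0).base = (x 0 * x 1).base := inf_comm _ _
  rw [h1 P hP _ h01, h1 P hP _ (h10 ▸ h01)]
  have key : (diagonal D m P fun a b => f (b * (x 0 * x 1) * a)) =
      diagonal D m P fun a b => f (b * (x 1 * x 0) * a) := by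
    -- The index of `x 1` need not lie in `P`; multiplying by the central idempotent `ε` puts it
    -- there without changing the products.
    set ε := idem D (x 0 * x 1).base with hε
    have hy : (ε * x 1).base ∈ P := by
      have : (ε * x 1).base = (x 0 * x 1).base := by
        rw [base_mul, hε]
        exact inf_eq_left.2 inf_le_right
      rwa [this]
    have e1 : ∀ a b, b * (x 0 * x 1) * a = b * x 0 * (ε * x 1 * a) := fun a b => by
      rw [← mul_idem_base (x 0 * x 1), mul_assoc (x 0), ← idem_comm, ← hε]
      simp only [mul_assoc]
    have e2 : ∀ a b, b * (x 1 * x 0) * a = b * (ε * x 1) * x 0 * a := fun a b => by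
      rw [← idem_mul_base (x 1 * x 0), h10, ← hε]
      simp only [mul_assoc]
    simp only [e1, e2]
    exact (diagonal_mul_comm hm hP (W := fun a b => f (b * x 0 * a)) (fun a b => hu _) hy).symm
  rw [key]
  ring

/-- Applying `bd` to the homotopy relation for `u` one degree below kills the term `bd h u`. -/
theorem bd_homotopy_bd (hm : ∀ e, IsInvariantMean (m e)) (n : ℕ)
    (u : (Fin (n + 1) → StrongSemilattice D) → ℂ) (C : ℝ) (hu : ∀ x, ‖u x‖ ≤ C) :
    bd n (homotopy D m n (bd n u)) = bd n u := by
  induction n generalizing C with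
  | zero => exact bd_homotopy_bd_zero hm hu
  | succ n ih =>
    have h := congrArg (bd (n + 1)) (bd_homotopy_add_of_bd_homotopy_bd hm ih hu)
    rwa [map_add, bd_bd, zero_add] at h

theorem bd_homotopy_add (hm : ∀ e, IsInvariantMean (m e))
    {F : (Fin (n + 2) → StrongSemilattice D) → ℂ} {C : ℝ} (hF : ∀ x, ‖F x‖ ≤ C) :
    bd n (homotopy D m n F) + homotopy D m (n + 1) (bd (n + 1) F) = F :=
  bd_homotopy_add_of_bd_homotopy_bd hm (bd_homotopy_bd hm n) hF

end StrongSemilattice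

/-! ### Solving `T x = y` by a dual estimate -/

/-- If every functional `f` satisfies `‖f y‖ ≤ C ‖f T‖ ‖y‖`, then `y` is approximated to within half
of its norm by the image under `T` of an element of comparable norm. -/
theorem exists_approx_preimage_of_dual_bound {X Y : Type*} [NormedAddCommGroup X] [NormedSpace ℂ X]
    [NormedAddCommGroup Y] [NormedSpace ℂ Y] (T : X →L[ℂ] Y) {C : ℝ} (hC : 0 < C) (y : Y)
    (h : ∀ f : Y →L[ℂ] ℂ, ‖f y‖ ≤ C * ‖f.comp T‖ * ‖y‖) :
    ∃ x, ‖x‖ ≤ C * ‖y‖ ∧ ‖y - T x‖ ≤ 2⁻¹ * ‖y‖ := by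
  by_cases hy0 : y = 0
  · exact ⟨0, by simp [hy0]⟩
  have hy : 0 < ‖y‖ := norm_pos_iff.2 hy0
  let s : Set Y := T '' Metric.closedBall 0 (C * ‖y‖)
  have hr : 0 < C * ‖y‖ := mul_pos hC hy
  -- Otherwise Hahn–Banach separates `y` from the convex set `s`; the bound of the separating `f` on
  -- `s` controls `‖f.comp T‖` and contradicts `h f`.
  have hs : y ∈ closure s := by
    by_contra hys
    have hconv : Convex ℝ s :=
      (convex_closedBall (0 : X) (C * ‖y‖)).is_linear_image
        ((T.restrictScalars ℝ).toLinearMap.isLinear)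
    obtain ⟨f, u, hfu, huy⟩ := RCLike.geometric_hahn_banach_closed_point (𝕜 := ℂ) hconv.closure
      isClosed_closure hys
    have hu : ∀ x, ‖x‖ ≤ C * ‖y‖ → (f (T x)).re ≤ u := fun x hx =>
      (hfu _ (subset_closure ⟨x, by simpa using hx, rfl⟩)).le
    have hu0 : 0 ≤ u := by simpa using hu 0 (by simpa using hr.le)
    have hb : ‖f.comp T‖ ≤ u / (C * ‖y‖) := by
      refine ContinuousLinearMap.opNorm_le_bound _ (div_nonneg hu0 hr.le) fun x => ?_
      by_cases hx0 : x = 0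
      · simp [hx0]
      have hx : 0 < ‖x‖ := norm_pos_iff.2 hx0
      obtain ⟨c, hc, hcx⟩ := RCLike.exists_norm_eq_mul_self (f (T x))
      have h1 := hu (((C * ‖y‖ / ‖x‖ : ℝ) : ℂ) • c • x) (by
        rw [norm_smul, norm_smul, hc, Complex.norm_real, Real.norm_of_nonneg (by positivity)]
        field_simp
        rfl)
      rw [map_smul, map_smul, map_smul, map_smul, smul_eq_mul, smul_eq_mul, ← hcx] at h1
      have h2 : C * ‖y‖ / ‖x‖ * ‖f (T x)‖ ≤ u := by simpa using h1
      rw [ContinuousLinearMap.comp_apply, div_mul_eq_mul_div, le_div_iff₀ hr]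
      rw [div_mul_eq_mul_div, div_le_iff₀ hx] at h2
      linarith
    have h3 : ‖f y‖ ≤ u := by
      refine (h f).trans ?_
      rw [le_div_iff₀ hr] at hb
      linarith
    exact absurd huy (not_lt.2 ((Complex.re_le_norm (f y)).trans h3))
  obtain ⟨_, ⟨x, hx, rfl⟩, hxy⟩ := Metric.mem_closure_iff.1 hs (2⁻¹ * ‖y‖) (by positivity)
  exact ⟨x, by simpa using hx, by rw [← dist_eq_norm]; exact hxy.le⟩

/-- If `R T = 0` and every functional `f` satisfies `‖f y‖ ≤ C ‖f T‖ ‖y‖` on `ker R`, then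
`ker R` is the range of `T`. -/
theorem exists_preimage_of_dual_bound {X Y Z : Type*} [NormedAddCommGroup X] [NormedSpace ℂ X]
    [CompleteSpace X] [NormedAddCommGroup Y] [NormedSpace ℂ Y] [AddCommGroup Z] [Module ℂ Z]
    (T : X →L[ℂ] Y) (R : Y →ₗ[ℂ] Z) (hRT : ∀ x, R (T x) = 0) {C : ℝ} (hC : 0 < C)
    (h : ∀ y, R y = 0 → ∀ f : Y →L[ℂ] ℂ, ‖f y‖ ≤ C * ‖f.comp T‖ * ‖y‖) (y : Y) (hy : R y = 0) :
    ∃ x, T x = y := by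
  choose g hg hg' using fun y : LinearMap.ker R =>
    exists_approx_preimage_of_dual_bound T hC y.1 (h y.1 y.2)
  -- Successive approximation as in the open mapping theorem: the residual stays in `ker R` because
  -- `R T = 0`, and its norm is halved each time.
  let next : LinearMap.ker R → LinearMap.ker R := fun y =>
    ⟨y.1 - T (g y), by rw [LinearMap.mem_ker, map_sub, hRT, y.2, sub_zero]⟩
  let v : ℕ → LinearMap.ker R := fun k => next^[k] ⟨y, hy⟩
  have hv : ∀ k, (v (k + 1)).1 = (v k).1 - T (g (v k)) := fun k => by
    simp only [v, Function.iterate_succ_apply', next]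
  have hvn : ∀ k, ‖(v k).1‖ ≤ (2⁻¹ : ℝ) ^ k * ‖y‖ := by
    intro k
    induction k with
    | zero => simp [v]
    | succ k ih =>
      rw [hv, pow_succ']
      have := hg' (v k)
      linarith
  have hgeom : Summable fun k : ℕ => (2⁻¹ : ℝ) ^ k :=
    summable_geometric_of_lt_one (by norm_num) (by norm_num)
  have hsum : Summable fun k => g (v k) := by
    refine Summable.of_norm_bounded (hgeom.mul_left (C * ‖y‖)) fun k => (hg _).trans ?_
    have := mul_le_mul_of_nonneg_left (hvn k) hC.le
    linarith
  have hlim : Filter.Tendsto (fun k => (v k).1) Filter.atTop (nhds 0) := by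
    refine squeeze_zero_norm hvn ?_
    simpa using hgeom.tendsto_atTop_zero.mul_const ‖y‖
  refine ⟨∑' k, g (v k), ?_⟩
  have hT := (hsum.hasSum.mapL T).tendsto_sum_nat
  have hpart : ∀ k, ∑ i ∈ Finset.range k, T (g (v i)) = y - (v k).1 := by
    intro k
    induction k with
    | zero => simp [v]
    | succ k ih =>
      rw [Finset.sum_range_succ, ih, hv]
      abel
  simp only [hpart] at hT
  exact tendsto_nhds_unique hT (by simpa using hlim.const_sub y)

/-! ### Multilinear maps on `ℓ¹(S)` -/

namespace Ell1

variable {S : Type*} [DecidableEq S]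

theorem norm_delta (s : S) : ‖delta s‖ = 1 := by
  rw [delta, lp.norm_single (by simp), norm_one]

theorem exists_clm {E : Type*} [NormedAddCommGroup E] [NormedSpace ℂ E] [CompleteSpace E]
    (v : S → E) {C : ℝ} (hC : 0 ≤ C) (hv : ∀ s, ‖v s‖ ≤ C) :
    ∃ T : Ell1 S →L[ℂ] E, (∀ s, T (delta s) = v s) ∧ ‖T‖ ≤ C := by
  have hb : ∀ (f : Ell1 S) s, ‖f s • v s‖ ≤ ‖f s‖ * C := fun f s => by
    rw [norm_smul]
    exact mul_le_mul_of_nonneg_left (hv s) (norm_nonneg _)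
  have hs : ∀ f : Ell1 S, Summable fun s => f s • v s := fun f =>
    Summable.of_norm_bounded (f.summable_norm.mul_right C) (hb f)
  let T : Ell1 S →ₗ[ℂ] E :=
    { toFun := fun f => ∑' s, f s • v s
      map_add' := fun f g => by
        rw [← (hs f).tsum_add (hs g)]
        simp only [lp.coeFn_add, Pi.add_apply, add_smul]
      map_smul' := fun c f => by
        rw [RingHom.id_apply, ← (hs f).tsum_const_smul]
        simp only [lp.coeFn_smul, Pi.smul_apply, smul_eq_mul, mul_smul] }
  refine ⟨T.mkContinuous C fun f => ?_, fun s => ?_, LinearMap.mkContinuous_norm_le _ hC _⟩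
  · change ‖∑' s, f s • v s‖ ≤ _
    refine (tsum_of_norm_bounded (f.summable_norm.mul_right C).hasSum (hb f)).trans (le_of_eq ?_)
    rw [tsum_mul_right, norm_eq, mul_comm]
  · change ∑' t, (delta s : Ell1 S) t • v t = v s
    rw [tsum_eq_single s]
    · simp [delta]
    · intro t ht
      simp [delta, lp.single_apply, Pi.single_apply, ht]

/-- Currying the first variable gives a bounded family, indexed by `S`, in a Banach space of
multilinear maps, to which `exists_clm` applies. -/
theorem exists_multilinear {n : ℕ} (Φ : (Fin n → S) → ℂ) {C : ℝ} (hC : 0 ≤ C)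
    (hΦ : ∀ x, ‖Φ x‖ ≤ C) :
    ∃ M : ContinuousMultilinearMap ℂ (fun _ : Fin n => Ell1 S) ℂ,
      (∀ x, M (fun i => delta (x i)) = Φ x) ∧ ‖M‖ ≤ C := by
  induction n with
  | zero =>
    refine ⟨ContinuousMultilinearMap.constOfIsEmpty ℂ _ (Φ Fin.elim0), fun x => ?_, ?_⟩
    · rw [ContinuousMultilinearMap.constOfIsEmpty_apply, Subsingleton.elim x Fin.elim0]
    · rw [ContinuousMultilinearMap.norm_constOfIsEmpty]
      exact hΦ _
  | succ n ih =>
    choose M hM hMC using fun s : S => ih (fun x => Φ (Fin.cons s x)) fun x => hΦ _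
    obtain ⟨T, hT, hTC⟩ := exists_clm M hC hMC
    refine ⟨ContinuousLinearMap.uncurryLeft (Ei := fun _ : Fin (n + 1) => Ell1 S) T,
      fun x => ?_, ?_⟩
    · rw [ContinuousLinearMap.uncurryLeft_apply, hT]
      exact (hM (x 0) (Fin.tail x)).trans (congrArg Φ (Fin.cons_self_tail x))
    · rwa [ContinuousLinearMap.uncurryLeft_norm]

theorem multilinear_ext {n : ℕ} {E : Type*} [NormedAddCommGroup E] [NormedSpace ℂ E]
    {M N : ContinuousMultilinearMap ℂ (fun _ : Fin n => Ell1 S) E}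
    (h : ∀ x : Fin n → S, M (fun i => delta (x i)) = N fun i => delta (x i)) : M = N := by
  induction n with
  | zero =>
    ext x
    rw [Subsingleton.elim x fun i => delta (Fin.elim0 i : S)]
    exact h _
  | succ n ih =>
    have : M.curryLeft = N.curryLeft := ext_clm fun s => ih fun x => by
      have := h (Fin.cons s x)
      have hc : (fun i => delta ((Fin.cons s x : Fin (n + 1) → S) i)) =
          Fin.cons (delta s) fun i => delta (x i) := by
        funext i
        refine Fin.cases rfl (fun i => rfl) i
      rwa [hc] at this
    ext x
    have := congrArg (fun T => T (x 0) (Fin.tail x)) this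
    simpa using this

variable [Semigroup S]

open Hochschild SemigroupCochain

theorem contract_delta {n : ℕ} (i : Fin (n + 1)) (x : Fin (n + 2) → S) :
    contract i (fun k => delta (x k)) = fun k => delta (face i.castSucc x k) := by
  funext k
  have hi := i.isLt
  unfold contract Fin.contractNth face
  simp only [Fin.val_castSucc]
  split_ifs
  · omega
  · rfl
  · exact delta_mul_delta _ _
  · rfl

theorem cyclicContract_delta {n : ℕ} (x : Fin (n + 2) → S) :
    cyclicContract (fun k => delta (x k)) = fun k => delta (face (Fin.last (n + 1)) x k) := by
  funext k
  refine Fin.cases ?_ (fun k => ?_) k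
  · simp [cyclicContract, face, delta_mul_delta]
  · simp [cyclicContract, face]

theorem sum_contract_delta {n : ℕ} {E : Type*} [AddCommGroup E] [Module ℂ E]
    (f : (Fin (n + 1) → Ell1 S) → E) (x : Fin (n + 2) → S) :
    (∑ i : Fin (n + 1), (-1 : ℂ) ^ (i : ℕ) • f (contract i fun k => delta (x k))) +
      (-1 : ℂ) ^ (n + 1) • f (cyclicContract fun k => delta (x k)) =
    ∑ i : Fin (n + 2), (-1 : ℂ) ^ (i : ℕ) • f fun k => delta (face i x k) := by
  rw [Fin.sum_univ_castSucc (n := n + 1)]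
  simp only [contract_delta, cyclicContract_delta, Fin.val_castSucc, Fin.val_last]

end Ell1

namespace Hochschild

open Ell1 SemigroupCochain

variable {S : Type*} [DecidableEq S] [Semigroup S]

/-! ### Cochains of `ℓ¹(S)` as bounded functions -/

/-- The function `(s_0, …, s_n) ↦ T(δ_{s_1}, …, δ_{s_n})(δ_{s_0})`. -/
noncomputable def cochainValues {n : ℕ} (T : Cochains (Ell1 S) n) (x : Fin (n + 1) → S) : ℂ :=
  T (fun i => delta (x i.succ)) (delta (x 0))

theorem cochainValues_injective {n : ℕ} {T U : Cochains (Ell1 S) n}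
    (h : cochainValues T = cochainValues U) : T = U := by
  refine multilinear_ext fun x => ext_clm fun s => ?_
  exact congrFun h (Fin.cons s x)

theorem exists_norm_cochainValues_le {n : ℕ} (T : Cochains (Ell1 S) n) :
    ∃ C, ∀ x, ‖cochainValues T x‖ ≤ C := by
  let T' : ContinuousMultilinearMap ℂ (fun _ : Fin n => Ell1 S) (DualModule (Ell1 S)) := T
  refine ⟨‖T'‖, fun x => ?_⟩
  have h1 := (T' fun i => delta (x i.succ)).le_opNorm (delta (x 0))
  have h2 := T'.le_opNorm fun i => delta (x i.succ)
  simp only [norm_delta, Finset.prod_const_one, mul_one] at h1 h2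
  exact h1.trans h2

theorem exists_cochainValues_eq {n : ℕ} (F : (Fin (n + 1) → S) → ℂ) {C : ℝ}
    (hF : ∀ x, ‖F x‖ ≤ C) : ∃ T : Cochains (Ell1 S) n, cochainValues T = F := by
  obtain ⟨M, hM, -⟩ := exists_multilinear F (le_max_right C 0) fun x =>
    (hF x).trans (le_max_left C 0)
  let T : ContinuousMultilinearMap ℂ (fun _ : Fin n => Ell1 S) (DualModule (Ell1 S)) :=
    M.curryLeft.flipMultilinear
  refine ⟨T, funext fun x => ?_⟩
  rw [← hM x]
  change M (Fin.cons (delta (x 0)) fun i : Fin n => delta (x i.succ)) = _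
  congr 1
  funext i
  refine Fin.cases rfl (fun i => rfl) i

/-- With the evaluation variable as coordinate `0`, the left action yields face `0` and the right
action the cyclic face. -/
theorem cochainValues_coboundary {n : ℕ} (T : Cochains (Ell1 S) n) :
    cochainValues (coboundary (Ell1 S) n T) = bd n (cochainValues T) := by
  funext x
  have hT : ∀ (a b : Fin n → Ell1 S) (c d : Ell1 S), a = b → c = d → T a c = T b d := by
    rintro a b c d rfl rfl
    rfl
  rw [bd_apply, Fin.sum_univ_succ, Fin.sum_univ_castSucc, ← add_assoc, cochainValues,
    coboundary_apply, _root_.add_apply, _root_.add_apply, _root_.sum_apply]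
  congr 1
  · congr 1
    · rw [leftAction_apply, Fin.val_zero, pow_zero, one_mul, delta_mul_delta]
      refine hT _ _ _ _ (funext fun k => ?_) ?_
      · simp [face, Fin.tail]
      · simp [face]
    · refine Finset.sum_congr rfl fun i _ => ?_
      rw [_root_.smul_apply, smul_eq_mul, Fin.val_succ, Fin.val_castSucc]
      congr 1
      have hi := i.isLt
      refine hT _ _ _ _ (funext fun k => ?_) ?_
      · simp only [contract, Fin.contractNth, face, Fin.val_succ, Fin.val_castSucc,
          Nat.add_lt_add_iff_right, Nat.add_right_cancel_iff, Nat.add_eq_zero_iff, one_ne_zero,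
          and_false, false_and, if_false]
        split_ifs
        · rfl
        · exact delta_mul_delta _ _
        · rfl
      · simp [face, hi.ne]
  · rw [_root_.smul_apply, smul_eq_mul, Fin.val_succ, Fin.val_last, rightAction_apply,
      delta_mul_delta]
    congr 1
    refine hT _ _ _ _ (funext fun k => ?_) ?_
    · simp [face, Fin.init]
    · simp [face]

/-! ### Functionals on chains of `ℓ¹(S)` as bounded functions -/

/-- The function `(s_0, …, s_n) ↦ f(δ_{s_0} ⊗ ⋯ ⊗ δ_{s_n})`. -/
noncomputable def chainValues {n : ℕ} (f : Chains (Ell1 S) n →L[ℂ] ℂ) (x : Fin (n + 1) → S) : ℂ :=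
  f ((PiTensorProduct.tprod ℂ fun i => delta (x i) : ⨂[ℂ] _ : Fin (n + 1), Ell1 S) :
    Chains (Ell1 S) n)

theorem chains_clm_ext {n : ℕ} {E : Type*} [NormedAddCommGroup E] [NormedSpace ℂ E]
    {f g : Chains (Ell1 S) n →L[ℂ] E}
    (h : ∀ x : Fin (n + 1) → S,
      f ((PiTensorProduct.tprod ℂ fun i => delta (x i) : ⨂[ℂ] _ : Fin (n + 1), Ell1 S) :
        Chains (Ell1 S) n) =
      g ((PiTensorProduct.tprod ℂ fun i => delta (x i) : ⨂[ℂ] _ : Fin (n + 1), Ell1 S) :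
        Chains (Ell1 S) n)) : f = g := by
  have h1 : (f.comp UniformSpace.Completion.toComplL).compContinuousMultilinearMap
      (PiTensorProduct.tprodL ℂ) = (g.comp
        UniformSpace.Completion.toComplL).compContinuousMultilinearMap
      (PiTensorProduct.tprodL ℂ) := multilinear_ext fun x => by simpa using h x
  have h2 : ∀ z : ⨂[ℂ] _ : Fin (n + 1), Ell1 S,
      f (z : Chains (Ell1 S) n) = g (z : Chains (Ell1 S) n) := by
    intro z
    induction z using PiTensorProduct.induction_on with
    | smul_tprod r x =>
      rw [UniformSpace.Completion.coe_smul, map_smul, map_smul]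
      congr 1
      simpa using congrArg (fun M => M x) h1
    | add z w hz hw => rw [UniformSpace.Completion.coe_add, map_add, map_add, hz, hw]
  ext z
  exact congrFun (UniformSpace.Completion.ext f.continuous g.continuous h2) z

theorem norm_chainValues_le {n : ℕ} (f : Chains (Ell1 S) n →L[ℂ] ℂ) (x : Fin (n + 1) → S) :
    ‖chainValues f x‖ ≤ ‖f‖ := by
  refine (f.le_opNorm _).trans (mul_le_of_le_one_right (norm_nonneg f) ?_)
  rw [UniformSpace.Completion.norm_coe]
  refine (PiTensorProduct.projectiveSeminorm_tprod_le _).trans ?_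
  simp [norm_delta]

theorem exists_chainValues_eq {n : ℕ} (F : (Fin (n + 1) → S) → ℂ) {C : ℝ} (hC : 0 ≤ C)
    (hF : ∀ x, ‖F x‖ ≤ C) :
    ∃ f : Chains (Ell1 S) n →L[ℂ] ℂ, chainValues f = F ∧ ‖f‖ ≤ C := by
  obtain ⟨M, hM, hMC⟩ := exists_multilinear F hC hF
  let φ : (⨂[ℂ] _ : Fin (n + 1), Ell1 S) →L[ℂ] ℂ :=
    PiTensorProduct.liftIsometry ℂ (fun _ : Fin (n + 1) => Ell1 S) ℂ M
  have hφ : ‖φ‖ ≤ C := ((PiTensorProduct.liftIsometry ℂ _ ℂ).norm_map M).trans_le hMC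
  refine ⟨φ.fromCompletion, funext fun x => ?_, ?_⟩
  · rw [chainValues, ContinuousLinearMap.fromCompletion_apply_coe, ← hM x]
    exact (PiTensorProduct.liftIsometry_apply_apply ..).trans (PiTensorProduct.lift.tprod _)
  · refine ContinuousLinearMap.opNorm_le_bound _ hC fun z => ?_
    induction z using UniformSpace.Completion.induction_on with
    | hp => exact isClosed_le (by fun_prop) (by fun_prop)
    | ih z =>
      rw [ContinuousLinearMap.fromCompletion_apply_coe, UniformSpace.Completion.norm_coe]
      exact (φ.le_opNorm z).trans (by gcongr)

theorem chainValues_comp_boundary {n : ℕ} (f : Chains (Ell1 S) n →L[ℂ] ℂ) :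
    chainValues (f.comp (boundary (Ell1 S) n)) = bd n (chainValues f) := by
  funext x
  rw [chainValues, ContinuousLinearMap.comp_apply, boundary_tprod, sum_contract_delta, bd_apply]
  have := map_sum (f.comp UniformSpace.Completion.toComplL) (fun i : Fin (n + 2) =>
    (-1 : ℂ) ^ (i : ℕ) • PiTensorProduct.tprod ℂ fun k => delta (face i x k)) Finset.univ
  refine this.trans (Finset.sum_congr rfl fun i _ => ?_)
  rw [map_smul]
  rfl

end Hochschild

/-! ### Simplicial triviality of `ℓ¹` of a Clifford semigroup with amenable constituents -/

namespace Hochschild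

open Ell1 SemigroupCochain

/-- Tested against functionals, this is `bd² = 0`. -/
theorem boundary_boundary {S : Type*} [Semigroup S] (n : ℕ) (z : Chains (Ell1 S) (n + 2)) :
    boundary (Ell1 S) n (boundary (Ell1 S) (n + 1) z) = 0 := by
  classical
  refine (SeparatingDual.eq_zero_iff_forall_dual_eq_zero (R := ℂ) _).2 fun f => ?_
  have : (f.comp (boundary (Ell1 S) n)).comp (boundary (Ell1 S) (n + 1)) = 0 :=
    chains_clm_ext fun x => by
      have h := chainValues_comp_boundary (f.comp (boundary (Ell1 S) n))
      rw [chainValues_comp_boundary f, bd_bd] at h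
      exact congrFun h x
  exact congrArg (fun g => g z) this

end Hochschild

namespace StrongSemilattice

open Hochschild SemigroupCochain

variable {L : Type*} [SemilatticeInf L] {G : L → Type*} [∀ e, Group (G e)]
  {D : SemilatticeDiagram L G} {m : ∀ e, (G e → ℂ) →ₗ[ℂ] ℂ} {n : ℕ}

theorem exists_coboundary_eq (hm : ∀ e, IsInvariantMean (m e))
    (T : Cochains (Ell1 (StrongSemilattice D)) (n + 1))
    (hT : coboundary (Ell1 (StrongSemilattice D)) (n + 1) T = 0) :
    ∃ U, coboundary (Ell1 (StrongSemilattice D)) n U = T := by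
  classical
  obtain ⟨C, hC⟩ := exists_norm_cochainValues_le T
  obtain ⟨U, hU⟩ := exists_cochainValues_eq (homotopy D m n (cochainValues T))
    (norm_homotopy_le hm hC)
  have h0 : bd (n + 1) (cochainValues T) = 0 := by
    rw [← cochainValues_coboundary, hT]
    rfl
  refine ⟨U, cochainValues_injective ?_⟩
  have h := bd_homotopy_add hm hC
  rwa [h0, map_zero, add_zero, ← hU, ← cochainValues_coboundary] at h

theorem exists_boundary_eq (hm : ∀ e, IsInvariantMean (m e))
    (z : Chains (Ell1 (StrongSemilattice D)) (n + 1))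
    (hz : boundary (Ell1 (StrongSemilattice D)) n z = 0) :
    ∃ w, boundary (Ell1 (StrongSemilattice D)) (n + 1) w = z := by
  classical
  have hB := homotopyBound_nonneg (n + 1)
  -- Adding `1` makes the constant positive; `homotopyBound` is only known to be nonnegative.
  refine exists_preimage_of_dual_bound _ (boundary (Ell1 (StrongSemilattice D)) n).toLinearMap
    (boundary_boundary n) (C := homotopyBound (n + 1) + 1) (by linarith) (fun y hy f => ?_) z hz
  have hF := norm_chainValues_le f
  have hF' := norm_chainValues_le (f.comp (boundary (Ell1 (StrongSemilattice D)) (n + 1)))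
  have h := bd_homotopy_add hm hF
  rw [← chainValues_comp_boundary] at h
  obtain ⟨g, hg, -⟩ := exists_chainValues_eq _
    (mul_nonneg (homotopyBound_nonneg n) (norm_nonneg f)) (norm_homotopy_le hm hF)
  let fd := f.comp (boundary (Ell1 (StrongSemilattice D)) (n + 1))
  obtain ⟨g', hg', hgB⟩ := exists_chainValues_eq (C := homotopyBound (n + 1) * ‖fd‖) _
    (mul_nonneg hB (norm_nonneg fd)) (norm_homotopy_le hm hF')
  -- The homotopy relation for the values of `f`, read back as functionals: `g` represents `h f` and
  -- `g'` represents `h (f ∘ d)`. On cycles only `g'` remains.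
  have hf : f = g.comp (boundary (Ell1 (StrongSemilattice D)) n) + g' := by
    refine chains_clm_ext fun x => ?_
    have hx := congrFun h x
    rw [← hg, ← hg', ← chainValues_comp_boundary] at hx
    exact hx.symm
  have hy' : boundary (Ell1 (StrongSemilattice D)) n y = 0 := hy
  have hfy : f y = g' y := by
    conv_lhs => rw [hf]
    rw [_root_.add_apply, ContinuousLinearMap.comp_apply, hy', map_zero, zero_add]
  rw [hfy]
  refine (g'.le_of_opNorm_le hgB y).trans ?_
  gcongr
  linarith

end StrongSemilattice

theorem proposition6p1 {L : Type*} [SemilatticeInf L] {G : L → Type*} [∀ e, Group (G e)]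
    (D : SemilatticeDiagram L G) (hG : ∀ e, IsAmenableGroup (G e)) (n : ℕ) (hn : 1 ≤ n) :
    Subsingleton (Hochschild.Homology (Ell1 (StrongSemilattice D)) n) ∧
      Subsingleton (Hochschild.Cohomology (Ell1 (StrongSemilattice D)) n) := by
  obtain ⟨n, rfl⟩ := Nat.exists_eq_add_of_le' hn
  choose m hm using fun e => (hG e).exists_isInvariantMean
  refine ⟨Submodule.Quotient.subsingleton_iff.2 (Submodule.eq_top_iff'.2 ?_),
    Submodule.Quotient.subsingleton_iff.2 (Submodule.eq_top_iff'.2 ?_)⟩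
  · rintro ⟨z, hz⟩
    exact StrongSemilattice.exists_boundary_eq hm z hz
  · rintro ⟨T, hT⟩
    exact StrongSemilattice.exists_coboundary_eq hm T hT
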